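/- Let $(A,\Psi)$ be a commutative Hopf algebroid with left and right units $\eta_L,\eta_R\colon A\to\Psi$, where $A$ is a regular local (Noetherian) ring whose maximal ideal $I$ is invariant, i.e. $\eta_L(I)\Psi=\eta_R(I)\Psi$. Tensor products are over $A$; in $\Psi\otimes M$ the right unit is used to form the tensor product and the left unit for the $A$-module structure. Let $C^I$ be $I$-adic completion of $A$-modules, $L_0$ its zeroth left derived functor, and $\eta\colon 1\to L_0$, $\epsilon\colon L_0\to C^I$ the natural transformations. Assume that (a) either $\Psi$ is a projective $A$-module, or $A$ is $I$-adically complete, $\Psi$ is flat over $A$ and $\eta_\Psi\colon\Psi\to L_0\Psi$ is injective; and (b) for every $\Psi$-comodule $N$ the canonical maps $\Psi\otimes C^I(N)\to C^I(\Psi\otimes N)$ and $\Psi\otimes C^I(\Psi\otimes N)\to C^I(\Psi\otimes\Psi\otimes N)$ are injective. For a $\Psi$-comodule $(M,\psi_M)$ give $L_0M$ the completed coaction $$\widehat\psi_M\colon L_0M\xrightarrow{L_0(\psi_M)}L_0(\Psi\otimes M)\xrightarrow{L_0(1\otimes\eta_M)}L_0(\Psi\otimes L_0M),$$ and consider the pullbacks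 of $A$-modules $$L_0^\Psi(M)=L_0M\times_{L_0(\Psi\otimes L_0M)}(\Psi\otimes L_0M),\qquad C^I_\Psi(M)=C^I(M)\times_{C^I(\Psi\otimes M)}(\Psi\otimes C^I(M)),$$ formed along $\widehat\psi_M$ and $\eta_{\Psi\otimes L_0M}$, respectively along $C^I(\psi_M)$ and the canonical map. In both cases write $i$ and $p$ for the projections to the first and second factor. Let $\epsilon'_M\colon L_0^\Psi(M)\to C^I_\Psi(M)$ be the map induced by $\epsilon_M$ and $1\otimes\epsilon_M$. Suppose that $M$ is a flat comodule, i.e. $M\otimes -$ preserves short exact sequences of $\Psi$-comodules. Then $L_0^\Psi(M)$ and $C^I_\Psi(M)$ carry $\Psi$-comodule structures $\rho$ with $(1\otimes i)\rho=p$ such that: (1) $L_0^\Psi(M)$ is the value at the $L$-complete comodule $L_0M$ of the right adjoint of the functor $L_0$ from $\Psi$-comodules to $L$-complete comodules: $i$ extends to a morphism of $L$-complete comodules $e\colon L_0(L_0^\Psi(M))\to L_0M$ (a map commuting with the completed coactions), and for every $\Psi$-comodule $X$ each morphism of $L$-complete comodules $L_0X\to L_0M$ is $e\circ L_0(g)$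 for a unique comodule morphism $g\colon X\to L_0^\Psi(M)$; (2) $C^I_\Psi(M)$, with the maps to $M/I^kM$ induced by $i$, is the inverse limit of the comodules $M\otimes A/I^k=M/I^kM$ in the category of $\Psi$-comodules; (3) $\epsilon'_M\colon L_0^\Psi(M)\to C^I_\Psi(M)$ is an isomorphism of $\Psi$-comodules. -/

import Mathlib

open CategoryTheory TensorProduct

universe u

/-! ## Commutative Hopf algebroids -/

/-- The ring `B`, regarded as an `A`-algebra through the ring homomorphism `f : A →+* B`. -/
def Via {A B : Type u} [CommRing A] [CommRing B] (_f : A →+* B) : Type u := B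

namespace Via

variable {A B : Type u} [CommRing A] [CommRing B] (f : A →+* B)

instance : CommRing (Via f) := inferInstanceAs (CommRing B)

instance : Algebra A (Via f) := f.toAlgebra

end Via

/-- The structure maps of a commutative Hopf algebroid `(A, Ψ)`, together with all the axioms except
coassociativity.  The tensor product `Ψ ⊗_A Ψ` is formed with the right unit `ηR` on the left factor
and the left unit `ηL` on the right factor. -/
structure HopfAlgebroidData (A Ψ : Type u) [CommRing A] [CommRing Ψ] where
  /-- the left unit -/
  ηL : A →+* Ψ
  /-- the right unit -/
  ηR : A →+* Ψ
  /-- the counit -/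
  ε : Ψ →+* A
  /-- the conjugation -/
  c : Ψ →+* Ψ
  /-- the diagonal -/
  Δ : Ψ →+* (Via ηR ⊗[A] Via ηL)
  ε_ηL : ∀ a, ε (ηL a) = a
  ε_ηR : ∀ a, ε (ηR a) = a
  c_ηL : ∀ a, c (ηL a) = ηR a
  c_ηR : ∀ a, c (ηR a) = ηL a
  c_c : ∀ x, c (c x) = x
  Δ_ηL : ∀ a, Δ (ηL a) = (show Via ηR from ηL a) ⊗ₜ[A] (1 : Via ηL)
  Δ_ηR : ∀ a, Δ (ηR a) = (1 : Via ηR) ⊗ₜ[A] (show Via ηL from ηR a)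
  /-- `(ε ⊗ 1) Δ = 1` -/
  counit_left : ∀ x : Ψ, Algebra.TensorProduct.productMap
    (show Via ηR →ₐ[A] Via ηL from
      { ηL.comp ε with commutes' := fun a => congrArg ηL (ε_ηR a) })
    (AlgHom.id A (Via ηL)) (Δ x) = x
  /-- `(1 ⊗ ε) Δ = 1` -/
  counit_right : ∀ x : Ψ, Algebra.TensorProduct.productMap
    (AlgHom.id A (Via ηR))
    (show Via ηL →ₐ[A] Via ηR from
      { ηR.comp ε with commutes' := fun a => congrArg ηR (ε_ηL a) }) (Δ x) = x
  /-- `μ (c ⊗ 1) Δ = ηR ε` -/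
  conj_left : ∀ x : Ψ, Algebra.TensorProduct.productMap
    (show Via ηR →ₐ[A] Via ηL from { c with commutes' := c_ηR })
    (AlgHom.id A (Via ηL)) (Δ x) = ηR (ε x)
  /-- `μ (1 ⊗ c) Δ = ηL ε` -/
  conj_right : ∀ x : Ψ, Algebra.TensorProduct.productMap
    (AlgHom.id A (Via ηR))
    (show Via ηL →ₐ[A] Via ηR from { c with commutes' := c_ηL }) (Δ x) = ηL (ε x)

namespace HopfAlgebroidData

variable {A Ψ : Type u} [CommRing A] [CommRing Ψ] (H : HopfAlgebroidData A Ψ)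

/-- `Ψ ⊗_A M` for an `A`-module `M`: the tensor product is formed through the right unit, and
the result is an `A`-module through the left unit. -/
def Tens (M : Type u) [AddCommGroup M] [Module A M] : Type u := Via H.ηR ⊗[A] M

section Tens

variable {M N P : Type u} [AddCommGroup M] [Module A M] [AddCommGroup N] [Module A N]
  [AddCommGroup P] [Module A P]

instance : AddCommGroup (H.Tens M) := inferInstanceAs (AddCommGroup (Via H.ηR ⊗[A] M))

instance : Module Ψ (H.Tens M) :=
  inferInstanceAs (Module (Via H.ηR) (Via H.ηR ⊗[A] M))

instance : Module A (H.Tens M) := Module.compHom _ H.ηL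

/-- The pure tensor `x ⊗ m`. -/
def tmul (x : Ψ) (m : M) : H.Tens M := (show Via H.ηR from x) ⊗ₜ[A] m

theorem smul_eq (a : A) (t : H.Tens M) : a • t = H.ηL a • t := rfl

theorem smul_tmul (x y : Ψ) (m : M) : x • H.tmul y m = H.tmul (x * y) m := rfl

theorem tmul_smul (x : Ψ) (a : A) (m : M) : H.tmul x (a • m) = H.tmul (x * H.ηR a) m := by
  have h := TensorProduct.smul_tmul (R := A) a (show Via H.ηR from x) m
  refine h.symm.trans ?_
  rw [Algebra.smul_def, mul_comm]
  rfl

theorem tmul_add (x : Ψ) (m n : M) : H.tmul x (m + n) = H.tmul x m + H.tmul x n :=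
  TensorProduct.tmul_add _ _ _

theorem add_tmul (x y : Ψ) (m : M) : H.tmul (x + y) m = H.tmul x m + H.tmul y m :=
  TensorProduct.add_tmul _ _ _

theorem tens_induction {p : H.Tens M → Prop} (t : H.Tens M) (zero : p 0)
    (tmul : ∀ x m, p (H.tmul x m)) (add : ∀ s t, p s → p t → p (s + t)) : p t :=
  TensorProduct.induction_on t zero tmul add

theorem tens_hom_ext {f g : H.Tens M →ₗ[A] P} (h : ∀ x m, f (H.tmul x m) = g (H.tmul x m)) :
    f = g := by
  ext t
  induction t using H.tens_induction with
  | zero => simp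
  | tmul x m => exact h x m
  | add s t hs ht => simp [hs, ht]

/-- A biadditive map `Ψ × M → P` that is balanced over `A` (right unit) induces an additive map
`Ψ ⊗_A M → P`. -/
noncomputable def tensLiftAdd (f : Ψ →+ M →+ P)
    (h₁ : ∀ a x m, f (x * H.ηR a) m = f x (a • m)) : H.Tens M →+ P :=
  TensorProduct.liftAddHom (R := A) (M := Via H.ηR) (N := M) f (by
    intro a x m
    rw [Algebra.smul_def, mul_comm]
    exact h₁ a x m)

/-- A biadditive map `Ψ × M → P` that is balanced over `A` (right unit) and `A`-linear for the left
unit induces an `A`-linear map `Ψ ⊗_A M → P`. -/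
noncomputable def tensLift (f : Ψ →+ M →+ P) (h₁ : ∀ a x m, f (x * H.ηR a) m = f x (a • m))
    (h₂ : ∀ a x m, f (H.ηL a * x) m = a • f x m) : H.Tens M →ₗ[A] P where
  toFun := H.tensLiftAdd f h₁
  map_add' := map_add _
  map_smul' := by
    intro a t
    induction t using H.tens_induction with
    | zero => rw [smul_zero, map_zero, smul_zero]
    | tmul x m => exact h₂ a x m
    | add s t hs ht => rw [smul_add, map_add, hs, ht, map_add, smul_add]

@[simp] theorem tensLift_tmul (f : Ψ →+ M →+ P) (h₁) (h₂) (x : Ψ) (m : M) :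
    H.tensLift f h₁ h₂ (H.tmul x m) = f x m := rfl

/-- The map `1 ⊗ f : Ψ ⊗_A M → Ψ ⊗_A N`. -/
noncomputable def tensMap (f : M →ₗ[A] N) : H.Tens M →ₗ[A] H.Tens N where
  toFun := LinearMap.lTensor (Via H.ηR) f
  map_add' := map_add _
  map_smul' a t := (LinearMap.baseChange (Via H.ηR) f).map_smul (show Via H.ηR from H.ηL a) t

@[simp] theorem tensMap_tmul (f : M →ₗ[A] N) (x : Ψ) (m : M) :
    H.tensMap f (H.tmul x m) = H.tmul x (f m) := rfl

theorem tensMap_comp (g : N →ₗ[A] P) (f : M →ₗ[A] N) :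
    H.tensMap (g ∘ₗ f) = H.tensMap g ∘ₗ H.tensMap f :=
  H.tens_hom_ext fun _ _ => rfl

theorem tensMap_smul (f : M →ₗ[A] N) (x : Ψ) (t : H.Tens M) :
    H.tensMap f (x • t) = x • H.tensMap f t :=
  (LinearMap.baseChange (Via H.ηR) f).map_smul (show Via H.ηR from x) t

/-- The map `Ψ → Ψ ⊗_A N`, `x ↦ x ⊗ n`, linear for the left units. -/
noncomputable def tmulRight (n : N) : Via H.ηL →ₗ[A] H.Tens N where
  toFun x := H.tmul x n
  map_add' x y := H.add_tmul x y n
  map_smul' a x := by rw [Algebra.smul_def]; rfl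

@[simp] theorem tmulRight_apply (n : N) (x : Via H.ηL) : H.tmulRight n x = H.tmul x n := rfl

/-- The diagonal, as a map of left `A`-modules. -/
noncomputable def comul : Via H.ηL →ₗ[A] H.Tens (Via H.ηL) where
  toFun x := H.Δ x
  map_add' := map_add H.Δ
  map_smul' a x := by
    have h1 : (a • x : Via H.ηL) = (H.ηL a * (show Ψ from x) : Ψ) := by
      rw [Algebra.smul_def]; rfl
    rw [h1, map_mul, H.Δ_ηL]
    have key : ∀ t : Via H.ηR ⊗[A] Via H.ηL,
        (show Via H.ηR from H.ηL a) ⊗ₜ[A] (1 : Via H.ηL) * t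
          = (show Via H.ηR from H.ηL a) • t := by
      intro t
      rw [Algebra.smul_def]; rfl
    exact key _

theorem comul_ηR (a : A) (x : Ψ) (n : N) :
    H.tensMap (H.tmulRight n) (H.Δ (x * H.ηR a)) =
      H.tensMap (H.tmulRight (a • n)) (H.Δ x) := by
  rw [map_mul, H.Δ_ηR]
  generalize H.Δ x = t
  induction t using TensorProduct.induction_on with
  | zero => rw [zero_mul]; exact (map_zero _).trans (map_zero _).symm
  | tmul y z =>
    rw [Algebra.TensorProduct.tmul_mul_tmul, mul_one]
    exact congrArg (H.tmul y) (H.tmul_smul z a n).symm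
  | add s t hs ht =>
    rw [add_mul]
    exact (map_add _ _ _).trans ((congrArg₂ (· + ·) hs ht).trans (map_add _ _ _).symm)

/-- The map `Δ ⊗ 1 : Ψ ⊗_A N → Ψ ⊗_A (Ψ ⊗_A N)`. -/
noncomputable def comulTens (N : Type u) [AddCommGroup N] [Module A N] :
    H.Tens N →ₗ[A] H.Tens (H.Tens N) :=
  H.tensLift
    (AddMonoidHom.mk'
      (fun x => AddMonoidHom.mk' (fun n => H.tensMap (H.tmulRight n) (H.comul x)) (by
        intro m n
        have h : H.tmulRight (m + n) = H.tmulRight m + H.tmulRight n := by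
          ext x; exact H.tmul_add x m n
        generalize H.comul x = t
        induction t using H.tens_induction with
        | zero => simp
        | tmul y z => rw [h]; exact H.tmul_add _ _ _
        | add s t hs ht => rw [map_add, map_add, map_add, hs, ht]; abel))
      (by
        intro x y
        ext n
        change H.tensMap (H.tmulRight n) (H.comul ((show Via H.ηL from x) + (show Via H.ηL from y)))
          = _
        rw [map_add, map_add]; rfl))
    (fun a x n => H.comul_ηR a x n)
    (fun a x n => by
      have h : ∀ y : Via H.ηL, H.tensMap (H.tmulRight n) (H.comul (a • y)) =
          a • H.tensMap (H.tmulRight n) (H.comul y) := fun y => by rw [map_smul, map_smul]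
      have e : a • (show Via H.ηL from x) = (show Via H.ηL from H.ηL a * x) := by
        rw [Algebra.smul_def]; rfl
      have h' := h x
      erw [e] at h'
      exact h')

theorem comulTens_tmul (x : Ψ) (n : N) :
    H.comulTens N (H.tmul x n) = H.tensMap (H.tmulRight n) (H.comul x) := rfl

/-- The map `ε ⊗ 1 : Ψ ⊗_A N → N`. -/
noncomputable def counitTens (N : Type u) [AddCommGroup N] [Module A N] : H.Tens N →ₗ[A] N :=
  H.tensLift
    (AddMonoidHom.mk' (fun x => AddMonoidHom.mk' (fun n => H.ε x • n) (smul_add _))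
      (by intro x y; ext n; simp [add_smul]))
    (fun a x n => by simp [H.ε_ηR, mul_smul])
    (fun a x n => by simp [H.ε_ηL, mul_smul])

theorem counitTens_tmul (x : Ψ) (n : N) : H.counitTens N (H.tmul x n) = H.ε x • n := rfl

theorem counitTens_natural (f : M →ₗ[A] N) :
    H.counitTens N ∘ₗ H.tensMap f = f ∘ₗ H.counitTens M :=
  H.tens_hom_ext fun x m => by simp [counitTens_tmul]

theorem comulTens_natural (f : M →ₗ[A] N) :
    H.comulTens N ∘ₗ H.tensMap f = H.tensMap (H.tensMap f) ∘ₗ H.comulTens M :=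
  H.tens_hom_ext fun x m => by
    simp only [LinearMap.comp_apply, tensMap_tmul, comulTens_tmul]
    rw [← LinearMap.comp_apply, ← tensMap_comp]
    rfl

end Tens

/-! ## Comodules -/

/-- The structure of a left `Ψ`-comodule on the `A`-module `M`. -/
structure Coaction (M : Type u) [AddCommGroup M] [Module A M] where
  /-- the coaction `ψ_M : M → Ψ ⊗_A M` -/
  coact : M →ₗ[A] H.Tens M
  counit : H.counitTens M ∘ₗ coact = LinearMap.id
  coassoc : H.tensMap coact ∘ₗ coact = H.comulTens M ∘ₗ coact

namespace Coaction

variable {H}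
variable {M N P : Type u} [AddCommGroup M] [Module A M] [AddCommGroup N] [Module A N]
  [AddCommGroup P] [Module A P]

/-- `f : M → N` is a morphism of `Ψ`-comodules. -/
def IsHom (ψ : H.Coaction M) (χ : H.Coaction N) (f : M →ₗ[A] N) : Prop :=
  χ.coact ∘ₗ f = H.tensMap f ∘ₗ ψ.coact

/-- The comodule `M` is flat: `M ⊗_A -` takes short exact sequences of comodules to short exact
sequences.  (For a flat Hopf algebroid, kernels and cokernels of comodules, and hence exactness,
are those of the underlying `A`-modules, and the underlying module of a tensor product of
comodules is the tensor product over `A`.) -/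
def IsFlat (_ψ : H.Coaction M) : Prop :=
  ∀ (X Y Z : Type u) [AddCommGroup X] [Module A X] [AddCommGroup Y] [Module A Y]
    [AddCommGroup Z] [Module A Z] (χX : H.Coaction X) (χY : H.Coaction Y) (χZ : H.Coaction Z)
    (f : X →ₗ[A] Y) (g : Y →ₗ[A] Z), IsHom χX χY f → IsHom χY χZ g →
    Function.Injective f → Function.Exact f g → Function.Surjective g →
    Function.Injective (f.lTensor M) ∧ Function.Exact (f.lTensor M) (g.lTensor M) ∧
      Function.Surjective (g.lTensor M)

end Coaction

/-! ## Invariant ideals and the comodules `M / I ^ k M` -/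

/-- The ideal `I` is invariant: `ηL(I)` and `ηR(I)` generate the same ideal of `Ψ`. -/
def IsInvariant (I : Ideal A) : Prop := I.map H.ηL = I.map H.ηR

section Invariant

variable {H}
variable {I : Ideal A}
variable {M N : Type u} [AddCommGroup M] [Module A M] [AddCommGroup N] [Module A N]

theorem IsInvariant.pow (hI : H.IsInvariant I) (k : ℕ) : H.IsInvariant (I ^ k) := by
  unfold IsInvariant at *
  rw [Ideal.map_pow, Ideal.map_pow, hI]

theorem smul_mem_of_mem_map {J : Ideal A} {x : Ψ} (hx : x ∈ J.map H.ηL) (t : H.Tens M) :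
    x • t ∈ (J • ⊤ : Submodule A (H.Tens M)) := by
  induction hx using Submodule.span_induction generalizing t with
  | mem x h =>
    obtain ⟨a, ha, rfl⟩ := h
    exact Submodule.smul_mem_smul ha (Submodule.mem_top (x := t))
  | zero => rw [zero_smul]; exact zero_mem _
  | add x y _ _ hx hy => rw [add_smul]; exact add_mem (hx t) (hy t)
  | smul y x _ hx => rw [smul_eq_mul, mul_comm, mul_smul]; exact hx _

theorem tmul_mem (hI : H.IsInvariant I) (k : ℕ) (x : Ψ) {m : M} (hm : m ∈ (I ^ k • ⊤ : Submodule A M)) :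
    H.tmul x m ∈ (I ^ k • ⊤ : Submodule A (H.Tens M)) := by
  induction hm using Submodule.smul_induction_on' with
  | smul a ha m _ =>
    rw [H.tmul_smul, mul_comm, ← H.smul_tmul]
    apply smul_mem_of_mem_map
    rw [hI.pow k]
    exact Ideal.mem_map_of_mem _ ha
  | add m _ n _ hm hn => rw [H.tmul_add]; exact add_mem hm hn

theorem smul_tens_quot_eq_zero (hI : H.IsInvariant I) (k : ℕ) {x : Ψ} (hx : x ∈ (I ^ k).map H.ηL)
    (t : H.Tens (M ⧸ (I ^ k • ⊤ : Submodule A M))) : x • t = 0 := by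
  rw [hI.pow k] at hx
  induction hx using Submodule.span_induction generalizing t with
  | mem x h =>
    obtain ⟨a, ha, rfl⟩ := h
    induction t using H.tens_induction with
    | zero => simp
    | tmul y m =>
      rw [H.smul_tmul, mul_comm, ← H.tmul_smul]
      obtain ⟨m, rfl⟩ := Submodule.Quotient.mk_surjective _ m
      have : a • (Submodule.Quotient.mk m : M ⧸ (I ^ k • ⊤ : Submodule A M)) = 0 := by
        rw [← Submodule.Quotient.mk_smul, Submodule.Quotient.mk_eq_zero]
        exact Submodule.smul_mem_smul ha Submodule.mem_top
      rw [this]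
      exact TensorProduct.tmul_zero _ _
    | add s t hs ht => rw [smul_add, hs, ht, add_zero]
  | zero => rw [zero_smul]
  | add x y _ _ hx hy => rw [add_smul, hx, hy, add_zero]
  | smul y x _ hx => rw [smul_eq_mul, mul_comm, mul_smul, hx]

/-- The quotient comodule `M / I ^ k M = M ⊗_A A / I ^ k`. -/
noncomputable def Coaction.quot (ψ : H.Coaction M) (hI : H.IsInvariant I) (k : ℕ) :
    H.Coaction (M ⧸ (I ^ k • ⊤ : Submodule A M)) where
  coact := Submodule.liftQ _ (H.tensMap (Submodule.mkQ _) ∘ₗ ψ.coact) (by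
    rw [Submodule.smul_le]
    intro a ha m _
    rw [LinearMap.mem_ker, map_smul, H.smul_eq]
    exact smul_tens_quot_eq_zero hI k (Ideal.mem_map_of_mem _ ha) _)
  counit := by
    apply Submodule.linearMap_qext
    rw [LinearMap.comp_assoc, Submodule.liftQ_mkQ, ← LinearMap.comp_assoc, counitTens_natural,
      LinearMap.comp_assoc, ψ.counit]
    rfl
  coassoc := by
    apply Submodule.linearMap_qext
    rw [LinearMap.comp_assoc, LinearMap.comp_assoc, Submodule.liftQ_mkQ, ← LinearMap.comp_assoc,
      ← LinearMap.comp_assoc, ← tensMap_comp, Submodule.liftQ_mkQ, tensMap_comp,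
      comulTens_natural, LinearMap.comp_assoc, ψ.coassoc, LinearMap.comp_assoc]

/-- The additive map `M / I ^ k M → (Ψ ⊗_A M) / I ^ k (Ψ ⊗_A M)`, `m ↦ x ⊗ m`. -/
def quotTmul (hI : H.IsInvariant I) (k : ℕ) (M : Type u) [AddCommGroup M] [Module A M] (x : Ψ) :
    (M ⧸ (I ^ k • ⊤ : Submodule A M)) →+ H.Tens M ⧸ (I ^ k • ⊤ : Submodule A (H.Tens M)) :=
  QuotientAddGroup.lift (I ^ k • ⊤ : Submodule A M).toAddSubgroup
    ((Submodule.mkQ (I ^ k • ⊤ : Submodule A (H.Tens M))).toAddMonoidHom.comp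
      (AddMonoidHom.mk' (H.tmul x) (H.tmul_add x)))
    (fun _ hm => (Submodule.Quotient.mk_eq_zero _).2 (tmul_mem hI k x hm))

/-- The natural map `Ψ ⊗_A (M / I ^ k M) → (Ψ ⊗_A M) / I ^ k (Ψ ⊗_A M)`, for an invariant ideal. -/
noncomputable def quotComparison (hI : H.IsInvariant I) (k : ℕ)
    (M : Type u) [AddCommGroup M] [Module A M] :
    H.Tens (M ⧸ (I ^ k • ⊤ : Submodule A M)) →ₗ[A]
      H.Tens M ⧸ (I ^ k • ⊤ : Submodule A (H.Tens M)) :=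
  H.tensLift
    (AddMonoidHom.mk' (quotTmul hI k M) (by
      intro x y
      ext m
      obtain ⟨m, rfl⟩ := Submodule.Quotient.mk_surjective _ m
      exact congrArg (Submodule.mkQ _) (H.add_tmul x y m)))
    (by
      intro a x m
      obtain ⟨m, rfl⟩ := Submodule.Quotient.mk_surjective _ m
      exact congrArg (Submodule.mkQ _) (H.tmul_smul x a m).symm)
    (by
      intro a x m
      obtain ⟨m, rfl⟩ := Submodule.Quotient.mk_surjective _ m
      rfl)

theorem quotComparison_tmul (hI : H.IsInvariant I) (k : ℕ) (x : Ψ) (m : M) :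
    quotComparison hI k M (H.tmul x (Submodule.Quotient.mk m)) =
      Submodule.Quotient.mk (H.tmul x m) := rfl

end Invariant

end HopfAlgebroidData

/-- A commutative Hopf algebroid `(A, Ψ)`. -/
structure HopfAlgebroid (A Ψ : Type u) [CommRing A] [CommRing Ψ] extends
    HopfAlgebroidData A Ψ where
  /-- `(1 ⊗ Δ) Δ = (Δ ⊗ 1) Δ` -/
  coassoc : toHopfAlgebroidData.tensMap toHopfAlgebroidData.comul ∘ₗ toHopfAlgebroidData.comul =
    toHopfAlgebroidData.comulTens (Via ηL) ∘ₗ toHopfAlgebroidData.comul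

/-! ## Completion and `L`-completion of modules -/

section Completion

variable {A : Type u} [CommRing A] (I : Ideal A)
variable {M N P : Type u} [AddCommGroup M] [Module A M] [AddCommGroup N] [Module A N]
  [AddCommGroup P] [Module A P]

/-- The map `C^I(f) : C^I(M) → C^I(N)`. -/
noncomputable def adicMap (f : M →ₗ[A] N) : AdicCompletion I M →ₗ[A] AdicCompletion I N :=
  (AdicCompletion.map I f).restrictScalars A

theorem eval_adicMap (f : M →ₗ[A] N) (k : ℕ) (m : AdicCompletion I M) :
    AdicCompletion.eval I N k (adicMap I f m) =
      Submodule.mapQ _ _ f (by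
        rw [Submodule.smul_le]
        intro a ha m _
        rw [Submodule.mem_comap, map_smul]
        exact Submodule.smul_mem_smul ha Submodule.mem_top) (AdicCompletion.eval I M k m) := rfl

theorem mapQ_add (n : ℕ) (f g : M →ₗ[A] N) :
    (LinearMap.reduceModIdeal (I ^ n) (f + g)).restrictScalars A =
      (LinearMap.reduceModIdeal (I ^ n) f).restrictScalars A +
        (LinearMap.reduceModIdeal (I ^ n) g).restrictScalars A := by
  apply Submodule.linearMap_qext
  rfl

/-- The `I`-adic completion functor `C^I`. -/
noncomputable def adicFunctor : ModuleCat.{u} A ⥤ ModuleCat.{u} A where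
  obj M := ModuleCat.of A (AdicCompletion I M)
  map f := ModuleCat.ofHom (adicMap I f.hom)
  map_id M := by
    apply ModuleCat.hom_ext
    apply LinearMap.ext
    intro x
    exact congrArg (fun g => g x) (AdicCompletion.map_id I (M := M))
  map_comp f g := by
    apply ModuleCat.hom_ext
    apply LinearMap.ext
    intro x
    exact (AdicCompletion.map_comp_apply I f.hom g.hom x).symm

instance : (adicFunctor I).Additive where
  map_add {M N f g} := by
    apply ModuleCat.hom_ext
    apply LinearMap.ext
    intro x
    apply AdicCompletion.ext
    intro n
    exact congrArg (fun h : (M ⧸ (I ^ n • ⊤ : Submodule A M)) →ₗ[A] _ => h (x.val n))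
      (mapQ_add I n f.hom g.hom)

/-- The natural transformation `M → C^I(M)`. -/
noncomputable def toAdicFunctor : 𝟭 (ModuleCat.{u} A) ⟶ adicFunctor I where
  app M := ModuleCat.ofHom (AdicCompletion.of I M)
  naturality _ _ _ := rfl

/-- The `L`-completion functor: the zeroth left derived functor of `I`-adic completion. -/
noncomputable abbrev LFunctor : ModuleCat.{u} A ⥤ ModuleCat.{u} A := (adicFunctor I).leftDerived 0

/-- The natural transformation `η : 1 → L_0`. -/
noncomputable def LUnit : 𝟭 (ModuleCat.{u} A) ⟶ LFunctor I :=
  (𝟭 (ModuleCat.{u} A)).leftDerivedZeroIsoSelf.inv ≫ NatTrans.leftDerived (toAdicFunctor I) 0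

/-- The natural transformation `ε : L_0 → C^I`. -/
noncomputable def LCounit : LFunctor I ⟶ adicFunctor I := (adicFunctor I).fromLeftDerivedZero

theorem leftDerived_comp_fromLeftDerivedZero {F G : ModuleCat.{u} A ⥤ ModuleCat.{u} A}
    [F.Additive] [G.Additive] (α : F ⟶ G) :
    NatTrans.leftDerived α 0 ≫ G.fromLeftDerivedZero = F.fromLeftDerivedZero ≫ α := by
  ext1
  ext1 X
  let Q := projectiveResolution X
  rw [NatTrans.comp_app, NatTrans.comp_app, ProjectiveResolution.leftDerived_app_eq α Q 0,
    ProjectiveResolution.fromLeftDerivedZero_eq Q F,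
    ProjectiveResolution.fromLeftDerivedZero_eq Q G, Category.assoc, Category.assoc,
    Iso.inv_hom_id_assoc, Category.assoc]
  refine congrArg (fun t => (Q.isoLeftDerivedObj F 0).hom ≫ t) ?_
  refine Eq.trans ?_ (Category.assoc _ _ _).symm
  have h1 := HomologicalComplex.homologyι_naturality
    ((NatTrans.mapHomologicalComplex α (ComplexShape.down ℕ)).app Q.complex) 0
  have h2 : HomologicalComplex.opcyclesMap
        ((NatTrans.mapHomologicalComplex α (ComplexShape.down ℕ)).app Q.complex) 0 ≫
      Q.fromLeftDerivedZero' G = Q.fromLeftDerivedZero' F ≫ α.app X := by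
    simp only [← cancel_epi (HomologicalComplex.pOpcycles _ _),
      HomologicalComplex.p_opcyclesMap_assoc,
      ProjectiveResolution.pOpcycles_comp_fromLeftDerivedZero',
      ProjectiveResolution.pOpcycles_comp_fromLeftDerivedZero'_assoc]
    exact (α.naturality _).symm
  rw [← h2]
  exact (reassoc_of% h1) _

theorem LUnit_comp_LCounit : LUnit I ≫ LCounit I = toAdicFunctor I := by
  have h1 := leftDerived_comp_fromLeftDerivedZero (toAdicFunctor I)
  have h2 := (𝟭 (ModuleCat.{u} A)).leftDerivedZeroIsoSelf_inv_hom_id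
  unfold LUnit LCounit
  rw [Category.assoc, h1, ← Category.assoc, h2, Category.id_comp]

/-- The `L`-completion `L_0 M` of the `A`-module `M`. -/
noncomputable abbrev L0 (M : Type u) [AddCommGroup M] [Module A M] : Type u :=
  (LFunctor I).obj (ModuleCat.of A M)

/-- The map `L_0(f) : L_0 M → L_0 N`. -/
noncomputable def L0map (f : M →ₗ[A] N) : L0 I M →ₗ[A] L0 I N :=
  ((LFunctor I).map (ModuleCat.ofHom f)).hom

/-- The natural map `η_M : M → L_0 M`. -/
noncomputable def L0unit (M : Type u) [AddCommGroup M] [Module A M] : M →ₗ[A] L0 I M :=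
  ((LUnit I).app (ModuleCat.of A M)).hom

/-- The natural map `ε_M : L_0 M → C^I(M)`. -/
noncomputable def L0counit (M : Type u) [AddCommGroup M] [Module A M] :
    L0 I M →ₗ[A] AdicCompletion I M :=
  ((LCounit I).app (ModuleCat.of A M)).hom

theorem L0counit_natural (f : M →ₗ[A] N) :
    L0counit I N ∘ₗ L0map I f = adicMap I f ∘ₗ L0counit I M :=
  congrArg ModuleCat.Hom.hom ((LCounit I).naturality (ModuleCat.ofHom f))

theorem L0counit_comp_L0unit : L0counit I M ∘ₗ L0unit I M = AdicCompletion.of I M :=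
  congrArg (fun α : 𝟭 (ModuleCat.{u} A) ⟶ adicFunctor I => (α.app (ModuleCat.of A M)).hom)
    (LUnit_comp_LCounit I)

end Completion

/-! ## Completion and `L`-completion of comodules -/

namespace HopfAlgebroidData

variable {A Ψ : Type u} [CommRing A] [CommRing Ψ] {H : HopfAlgebroidData A Ψ} {I : Ideal A}

/-- The canonical map `Ψ ⊗_A C^I(M) → C^I(Ψ ⊗_A M)`, for an invariant ideal `I`. -/
noncomputable def adicComparison (hI : H.IsInvariant I)
    (M : Type u) [AddCommGroup M] [Module A M] :
    H.Tens (AdicCompletion I M) →ₗ[A] AdicCompletion I (H.Tens M) :=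
  AdicCompletion.lift I
    (fun k => quotComparison hI k M ∘ₗ H.tensMap (AdicCompletion.eval I M k))
    (by
      intro m n hmn
      apply H.tens_hom_ext
      intro x y
      simp only [LinearMap.comp_apply, tensMap_tmul]
      have e : AdicCompletion.transitionMap I M hmn (AdicCompletion.eval I M n y) =
          AdicCompletion.eval I M m y :=
        LinearMap.congr_fun (AdicCompletion.transitionMap_comp_eval I M hmn) y
      rw [← e]
      obtain ⟨z, hz⟩ := Submodule.Quotient.mk_surjective _ (AdicCompletion.eval I M n y)
      rw [← hz]
      rfl)

theorem eval_adicComparison (hI : H.IsInvariant I) (M : Type u) [AddCommGroup M] [Module A M]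
    (k : ℕ) (t : H.Tens (AdicCompletion I M)) :
    AdicCompletion.eval I (H.Tens M) k (adicComparison hI M t) =
      quotComparison hI k M (H.tensMap (AdicCompletion.eval I M k) t) := rfl

namespace Coaction

variable {M : Type u} [AddCommGroup M] [Module A M]

/-- The completed coaction `L_0 M → L_0(Ψ ⊗_A M) → L_0(Ψ ⊗_A L_0 M) = Ψ ⊠_A L_0 M` of the
`L`-complete comodule `L_0 M`. -/
noncomputable def completed (I : Ideal A) (ψ : H.Coaction M) :
    L0 I M →ₗ[A] L0 I (H.Tens (L0 I M)) :=
  L0map I (H.tensMap (L0unit I M)) ∘ₗ L0map I ψ.coact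

/-- `f : L_0 M → L_0 N` is a morphism of `L`-complete comodules: it commutes with the completed
coactions. -/
def IsCompletedHom (I : Ideal A) {N : Type u} [AddCommGroup N] [Module A N] (ψ : H.Coaction M)
    (χ : H.Coaction N) (f : L0 I M →ₗ[A] L0 I N) : Prop :=
  χ.completed I ∘ₗ f = L0map I (H.tensMap f) ∘ₗ ψ.completed I

/-- The `A`-module underlying `L_0^Ψ(M)`: the pullback of the completed coaction
`L_0 M → Ψ ⊠_A L_0 M` along the natural map `Ψ ⊗_A L_0 M → L_0(Ψ ⊗_A L_0 M) = Ψ ⊠_A L_0 M`. -/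
noncomputable def LPsi (I : Ideal A) (ψ : H.Coaction M) :
    Submodule A (L0 I M × H.Tens (L0 I M)) :=
  LinearMap.eqLocus (ψ.completed I ∘ₗ LinearMap.fst A _ _)
    (L0unit I (H.Tens (L0 I M)) ∘ₗ LinearMap.snd A _ _)

/-- The `A`-module underlying `C^I_Ψ(M)`: the pullback of `C^I(ψ_M) : C^I(M) → C^I(Ψ ⊗_A M)`
along the canonical map `Ψ ⊗_A C^I(M) → C^I(Ψ ⊗_A M)`. -/
noncomputable def CPsi (hI : H.IsInvariant I) (ψ : H.Coaction M) :
    Submodule A (AdicCompletion I M × H.Tens (AdicCompletion I M)) :=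
  LinearMap.eqLocus (adicMap I ψ.coact ∘ₗ LinearMap.fst A _ _)
    (adicComparison hI M ∘ₗ LinearMap.snd A _ _)

/-- The projection `i : L_0^Ψ(M) → L_0 M`. -/
noncomputable def LPsi.i (I : Ideal A) (ψ : H.Coaction M) : ψ.LPsi I →ₗ[A] L0 I M :=
  LinearMap.fst A _ _ ∘ₗ (ψ.LPsi I).subtype

/-- The projection `p : L_0^Ψ(M) → Ψ ⊗_A L_0 M`. -/
noncomputable def LPsi.p (I : Ideal A) (ψ : H.Coaction M) : ψ.LPsi I →ₗ[A] H.Tens (L0 I M) :=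
  LinearMap.snd A _ _ ∘ₗ (ψ.LPsi I).subtype

/-- The projection `i : C^I_Ψ(M) → C^I(M)`. -/
noncomputable def CPsi.i (hI : H.IsInvariant I) (ψ : H.Coaction M) :
    ψ.CPsi hI →ₗ[A] AdicCompletion I M :=
  LinearMap.fst A _ _ ∘ₗ (ψ.CPsi hI).subtype

/-- The projection `p : C^I_Ψ(M) → Ψ ⊗_A C^I(M)`. -/
noncomputable def CPsi.p (hI : H.IsInvariant I) (ψ : H.Coaction M) :
    ψ.CPsi hI →ₗ[A] H.Tens (AdicCompletion I M) :=
  LinearMap.snd A _ _ ∘ₗ (ψ.CPsi hI).subtype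

theorem adicMap_coact_L0counit (hI : H.IsInvariant I) (ψ : H.Coaction M) (x : L0 I M)
    (y : H.Tens (L0 I M)) (h : ψ.completed I x = L0unit I (H.Tens (L0 I M)) y) :
    adicMap I ψ.coact (L0counit I M x) =
      adicComparison hI M (H.tensMap (L0counit I M) y) := by
  apply AdicCompletion.ext
  intro k
  change AdicCompletion.eval I (H.Tens M) k (adicMap I ψ.coact (L0counit I M x)) =
    AdicCompletion.eval I (H.Tens M) k (adicComparison hI M (H.tensMap (L0counit I M) y))
  rw [eval_adicComparison]
  let a : H.Tens (L0 I M) →ₗ[A] H.Tens M ⧸ (I ^ k • ⊤ : Submodule A (H.Tens M)) :=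
    quotComparison hI k M ∘ₗ H.tensMap (AdicCompletion.eval I M k) ∘ₗ H.tensMap (L0counit I M)
  have ha : (I ^ k • ⊤ : Submodule A (H.Tens (L0 I M))) ≤ LinearMap.ker a := by
    rw [Submodule.smul_le]
    intro r hr m _
    rw [LinearMap.mem_ker, map_smul]
    obtain ⟨w, hw⟩ := Submodule.Quotient.mk_surjective _ (a m)
    rw [← hw, ← Submodule.Quotient.mk_smul, Submodule.Quotient.mk_eq_zero]
    exact Submodule.smul_mem_smul hr Submodule.mem_top
  let b := Submodule.liftQ _ a ha
  have h1 : ∀ t : H.Tens (L0 I M), b (AdicCompletion.eval I _ k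
      (L0counit I _ (L0unit I (H.Tens (L0 I M)) t))) = a t := by
    intro t
    have := LinearMap.congr_fun (L0counit_comp_L0unit I (M := H.Tens (L0 I M))) t
    rw [LinearMap.comp_apply] at this
    rw [this]
    rfl
  have h0 : a ∘ₗ H.tensMap (L0unit I M) = Submodule.mkQ _ := by
    apply H.tens_hom_ext
    intro u m
    have e := LinearMap.congr_fun (L0counit_comp_L0unit I (M := M)) m
    rw [LinearMap.comp_apply] at e
    simp only [a, LinearMap.comp_apply, tensMap_tmul]
    rw [e]
    rfl
  have h2 : ∀ t : L0 I (H.Tens M), b (AdicCompletion.eval I _ k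
      (L0counit I _ (L0map I (H.tensMap (L0unit I M)) t))) =
        AdicCompletion.eval I _ k (L0counit I _ t) := by
    intro t
    have := LinearMap.congr_fun (L0counit_natural I (H.tensMap (L0unit I M))) t
    rw [LinearMap.comp_apply] at this
    rw [this, LinearMap.comp_apply, eval_adicMap]
    obtain ⟨w, hw⟩ := Submodule.Quotient.mk_surjective _
      (AdicCompletion.eval I (H.Tens M) k (L0counit I (H.Tens M) t))
    rw [← hw, Submodule.mapQ_apply]
    change a (H.tensMap (L0unit I M) w) = Submodule.Quotient.mk w
    exact LinearMap.congr_fun h0 w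
  have h3 := LinearMap.congr_fun (L0counit_natural I ψ.coact) x
  rw [LinearMap.comp_apply, LinearMap.comp_apply] at h3
  rw [← h3, ← h2]
  change b (AdicCompletion.eval I _ k (L0counit I _ (ψ.completed I x))) = a y
  rw [h, h1]

/-- The natural map `ε'_M : L_0^Ψ(M) → C^I_Ψ(M)`, induced on pullbacks by
`ε_M : L_0 M → C^I(M)` and `1 ⊗ ε_M : Ψ ⊗_A L_0 M → Ψ ⊗_A C^I(M)`. -/
noncomputable def epsilon' (hI : H.IsInvariant I) (ψ : H.Coaction M) :
    ψ.LPsi I →ₗ[A] ψ.CPsi hI :=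
  LinearMap.codRestrict _
    (LinearMap.prod (L0counit I M ∘ₗ LPsi.i I ψ) (H.tensMap (L0counit I M) ∘ₗ LPsi.p I ψ))
    (fun z => adicMap_coact_L0counit hI ψ _ _ z.2)

/-- The comodule `(E, ρ)` with the `A`-linear map `i : E → L_0 M` is the value at the `L`-complete
comodule `L_0 M` of the right adjoint of the functor `L_0` from comodules to `L`-complete
comodules: `i` extends to a morphism `e : L_0 E → L_0 M` of `L`-complete comodules that is
universal among the morphisms of `L`-complete comodules `L_0 X → L_0 M`, for `X` a comodule. -/
def IsCoreflection (ψ : H.Coaction M) {E : Type u} [AddCommGroup E] [Module A E]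
    (ρ : H.Coaction E) (i : E →ₗ[A] L0 I M) : Prop :=
  ∃ e : L0 I E →ₗ[A] L0 I M, IsCompletedHom I ρ ψ e ∧ e ∘ₗ L0unit I E = i ∧
    ∀ (X : Type u) [AddCommGroup X] [Module A X] (χ : H.Coaction X) (f : L0 I X →ₗ[A] L0 I M),
      IsCompletedHom I χ ψ f → ∃! g : X →ₗ[A] E, IsHom χ ρ g ∧ e ∘ₗ L0map I g = f

/-- The comodule `(E, ρ)` with the maps `π k : E → M / I ^ k M` is the inverse limit, in the category
of comodules, of the tower of comodules `M / I ^ k M`. -/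
def IsCompletion (hI : H.IsInvariant I) (ψ : H.Coaction M) {E : Type u} [AddCommGroup E]
    [Module A E] (ρ : H.Coaction E)
    (π : ∀ k : ℕ, E →ₗ[A] M ⧸ (I ^ k • ⊤ : Submodule A M)) : Prop :=
  (∀ k, IsHom ρ (ψ.quot hI k) (π k)) ∧
  (∀ k l (h : k ≤ l), AdicCompletion.transitionMap I M h ∘ₗ π l = π k) ∧
  ∀ (X : Type u) [AddCommGroup X] [Module A X] (χ : H.Coaction X)
    (f : ∀ k : ℕ, X →ₗ[A] M ⧸ (I ^ k • ⊤ : Submodule A M)),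
    (∀ k, IsHom χ (ψ.quot hI k) (f k)) →
    (∀ k l (h : k ≤ l), AdicCompletion.transitionMap I M h ∘ₗ f l = f k) →
    ∃! g : X →ₗ[A] E, IsHom χ ρ g ∧ ∀ k, π k ∘ₗ g = f k

end Coaction

end HopfAlgebroidData

/-!
The category of comodules enters only through the pullbacks.  Write `D = C^I(M)`.  The projection
`p : C^I_Ψ(M) → Ψ ⊗ D` is injective, because `i = (ε ⊗ 1) p` (`CPsi.counitTens_p`).  Its image is a
subcomodule of the extended comodule `Ψ ⊗ D`: as `Ψ` is flat, `Ψ ⊗ C^I_Ψ(M)` is a pullback as well,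
and the pair `(p, (Δ ⊗ 1) p)` lies in it since `Ψ ⊗ C^I(Ψ ⊗ M) → C^I(Ψ ⊗ Ψ ⊗ M)` is injective
(`CPsi.exists_tens`, `exists_coaction_CPsi`).  A comodule morphism `X → C^I_Ψ(M)` is then the same
as a linear map `h : X → D` that is compatible with the coactions up to the comparison map
`Ψ ⊗ D → C^I(Ψ ⊗ M)` (`existsUnique_hom_CPsi`).  Since `Ψ ⊗ M / I ^ k M` is
`(Ψ ⊗ M) / I ^ k (Ψ ⊗ M)`, the compatible maps are the compatible families of comodule morphisms
`X → M / I ^ k M`, which gives the inverse limit.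

For the comparison with `L_0` the flatness of `M` is applied to the exact sequences of comodules
`0 → I ^ k → A → A / I ^ k → 0`; the result is `Tor_1(A / I ^ k, M) = 0` for all `k`
(`IsFlat.injective_idealMul`), and flatness of `Ψ` and invariance of `I` give the same for `Ψ ⊗ M`
(`injective_idealMul_tens`).  If these groups vanish for a module `N`, then `L_0 N → C^I(N)` is an
isomorphism (`injective_L0counit`, `surjective_L0counit`).  Moreover `M → L_0 M` is surjective
modulo `I`, and `L_0` takes maps that are surjective modulo `I` to surjections (`surjective_L0map`).
Hence `L_0(Ψ ⊗ M) → L_0(Ψ ⊗ L_0 M)` is surjective, its composite with the map to `C^I(Ψ ⊗ M)` is the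
isomorphism just mentioned, and so `L_0(Ψ ⊗ L_0 M) → C^I(Ψ ⊗ M)` is injective
(`injective_boxComparison`).  The two pullbacks therefore agree (`bijective_epsilon'`).  Finally a
map from `L_0 X` to a completion is determined by its restriction to `X` (`L0_hom_ext`), so that
morphisms `L_0 X → L_0 M` of `L`-complete comodules are again the compatible maps `h : X → D`
(`isCompletedHom_iff`), and the universal property of `L_0^Ψ(M)` is that of `C^I_Ψ(M)`.
-/

/-! ### The zeroth left derived functor on epimorphisms -/

/-- The augmentation `P₀ ⟶ X` of a projective resolution remains epi after applying
`F.leftDerived 0`: on resolutions it is covered by the map from `P₀`, concentrated in degree `0`,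
which is the identity in that degree and therefore epi on opcycles. -/
theorem epi_leftDerived_map_π {C D : Type*} [Category* C] [Abelian C] [HasProjectiveResolutions C]
    [Category* D] [Abelian D] (F : C ⥤ D) [F.Additive] {X : C} (P : ProjectiveResolution X) :
    Epi ((F.leftDerived 0).map (P.π.f 0)) := by
  let S := ProjectiveResolution.self (P.complex.X 0)
  let φ : S.complex ⟶ P.complex := (ChainComplex.fromSingle₀Equiv P.complex _).symm (𝟙 _)
  have hφ : φ.f 0 = 𝟙 (P.complex.X 0) := ChainComplex.fromSingle₀Equiv_symm_apply_f_zero _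
  have hS : S.π.f 0 = 𝟙 (P.complex.X 0) := rfl
  have comm : φ.f 0 ≫ P.π.f 0 = S.π.f 0 ≫ P.π.f 0 := by
    rw [hφ, hS]
    rfl
  have h := ProjectiveResolution.isoLeftDerivedObj_inv_naturality (P.π.f 0) S P φ comm F 0
  have hop : Epi (HomologicalComplex.opcyclesMap ((F.mapHomologicalComplex _).map φ) 0) := by
    have e : Epi (((F.mapHomologicalComplex _).map φ).f 0 ≫
        ((F.mapHomologicalComplex _).obj P.complex).pOpcycles 0) := by
      have : IsIso (((F.mapHomologicalComplex (ComplexShape.down ℕ)).map φ).f 0) := by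
        change IsIso (F.map (φ.f 0))
        rw [hφ]
        exact inferInstanceAs (IsIso (F.map (𝟙 _)))
      infer_instance
    rw [← HomologicalComplex.p_opcyclesMap] at e
    exact epi_of_epi (HomologicalComplex.pOpcycles _ 0) _
  have hh : Epi (HomologicalComplex.homologyMap ((F.mapHomologicalComplex _).map φ) 0) := by
    have e := ChainComplex.isoHomologyι₀_inv_naturality ((F.mapHomologicalComplex _).map φ)
    have : Epi ((ChainComplex.isoHomologyι₀ _).inv ≫
        HomologicalComplex.homologyMap ((F.mapHomologicalComplex _).map φ) 0) := by
      rw [e]; infer_instance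
    exact epi_of_epi (ChainComplex.isoHomologyι₀ _).inv _
  have : Epi ((S.isoLeftDerivedObj F 0).inv ≫ (F.leftDerived 0).map (P.π.f 0)) := by
    rw [h]
    have h3 : Epi (P.isoLeftDerivedObj F 0).inv := IsIso.epi_of_iso _
    exact @epi_comp _ _ _ _ _ _ hh _ h3
  exact epi_of_epi (S.isoLeftDerivedObj F 0).inv _

/-! ### `L`-completion of modules -/

section LCompletion

variable {A : Type u} [CommRing A] {I : Ideal A}
variable {X Y Z : Type u} [AddCommGroup X] [Module A X] [AddCommGroup Y] [Module A Y]
  [AddCommGroup Z] [Module A Z]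

theorem L0map_comp (g : Y →ₗ[A] Z) (f : X →ₗ[A] Y) :
    L0map I (g ∘ₗ f) = L0map I g ∘ₗ L0map I f := by
  unfold L0map
  rw [ModuleCat.ofHom_comp, Functor.map_comp, ModuleCat.hom_comp]

theorem L0map_comp_L0unit (f : X →ₗ[A] Y) : L0map I f ∘ₗ L0unit I X = L0unit I Y ∘ₗ f :=
  (congrArg ModuleCat.Hom.hom ((LUnit I).naturality (ModuleCat.ofHom f))).symm

theorem adicMap_comp (g : Y →ₗ[A] Z) (f : X →ₗ[A] Y) :
    adicMap I (g ∘ₗ f) = adicMap I g ∘ₗ adicMap I f :=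
  LinearMap.ext fun x => (AdicCompletion.map_comp_apply I f g x).symm

theorem adicMap_id : adicMap I (LinearMap.id : X →ₗ[A] X) = LinearMap.id :=
  LinearMap.ext fun x => congrArg (fun g => g x) (AdicCompletion.map_id I (M := X))

theorem bijective_L0counit_of_projective (I : Ideal A) (X : Type u) [AddCommGroup X] [Module A X]
    [Module.Projective A X] : Function.Bijective (L0counit I X) := by
  have : Projective (ModuleCat.of A X) := (IsProjective.iff_projective X).1 inferInstance
  exact ConcreteCategory.bijective_of_isIso
    ((adicFunctor I).fromLeftDerivedZero.app (ModuleCat.of A X))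

theorem L0map_zero : L0map I (0 : X →ₗ[A] Y) = 0 := by
  -- The zero map factors through the projective module `0`, whose `L_0` is `C^I(0) = 0`.
  have h : Subsingleton (AdicCompletion I PUnit.{u + 1}) :=
    ⟨fun _ _ => AdicCompletion.ext fun _ => Subsingleton.elim _ _⟩
  have h' : Subsingleton (L0 I PUnit.{u + 1}) :=
    (bijective_L0counit_of_projective I PUnit.{u + 1}).1.subsingleton
  have e : (0 : X →ₗ[A] Y) = (0 : PUnit.{u + 1} →ₗ[A] Y) ∘ₗ (0 : X →ₗ[A] PUnit.{u + 1}) := rfl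
  rw [e, L0map_comp]
  ext1 x
  rw [LinearMap.comp_apply, Subsingleton.elim (L0map I (0 : X →ₗ[A] PUnit.{u + 1}) x) 0, map_zero,
    LinearMap.zero_apply]

/-- Every module `Y` is the target of a surjection from a projective module that remains surjective
under `L_0`. -/
theorem exists_projective_surjective_L0map (I : Ideal A) (Y : Type u) [AddCommGroup Y]
    [Module A Y] :
    ∃ (F : ModuleCat.{u} A) (_ : Module.Projective A F) (π : F →ₗ[A] Y),
      Function.Surjective π ∧ Function.Surjective (L0map I π) := by
  let P := projectiveResolution (ModuleCat.of A Y)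
  refine ⟨P.complex.X 0, (IsProjective.iff_projective _).2 (P.projective 0), (P.π.f 0).hom, ?_, ?_⟩
  · exact (ModuleCat.epi_iff_surjective _).1 (inferInstanceAs (Epi (P.π.f 0)))
  · have := epi_leftDerived_map_π (adicFunctor I) P
    exact (ModuleCat.epi_iff_surjective _).1 this

theorem surjective_adicMap (f : X →ₗ[A] Y) (hf : ∀ y, ∃ x, y - f x ∈ (I • ⊤ : Submodule A Y)) :
    Function.Surjective (adicMap I f) := by
  refine AdicCompletion.map_surjective_of_mkQ_comp_surjective (f := f) fun y => ?_
  obtain ⟨y, rfl⟩ := Submodule.Quotient.mk_surjective _ y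
  obtain ⟨x, hx⟩ := hf y
  exact ⟨x, ((Submodule.Quotient.eq _).2 hx).symm⟩

theorem surjective_L0counit (I : Ideal A) (Y : Type u) [AddCommGroup Y] [Module A Y] :
    Function.Surjective (L0counit I Y) := by
  obtain ⟨F, _, π, hπ, -⟩ := exists_projective_surjective_L0map I Y
  have h1 : Function.Surjective (adicMap I π) :=
    surjective_adicMap π fun y => (hπ y).imp fun x hx => by rw [hx, sub_self]; exact zero_mem _
  have h2 := h1.comp (bijective_L0counit_of_projective I F).2
  have h3 : Function.Surjective (adicMap I π ∘ₗ L0counit I F) := h2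
  rw [← L0counit_natural] at h3
  exact Function.Surjective.of_comp h3

/-- A map that is surjective modulo `I` is surjective on `L_0`.  The fibre product `Z = X ×_Y F`
with a projective module `F → Y` maps onto `F` modulo `I`, hence `C^I(Z) → C^I(F) = L_0 F` is
surjective, and `L_0 Z → L_0 F → L_0 Y` factors through `L_0 X`. -/
theorem surjective_L0map (f : X →ₗ[A] Y) (hf : ∀ y, ∃ x, y - f x ∈ (I • ⊤ : Submodule A Y)) :
    Function.Surjective (L0map I f) := by
  obtain ⟨F, _, π, hπ, hLπ⟩ := exists_projective_surjective_L0map I Y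
  let Z : Submodule A (X × F) :=
    LinearMap.eqLocus (f ∘ₗ LinearMap.fst A X F) (π ∘ₗ LinearMap.snd A X F)
  let a : Z →ₗ[A] X := LinearMap.fst A X F ∘ₗ Z.subtype
  let b : Z →ₗ[A] F := LinearMap.snd A X F ∘ₗ Z.subtype
  have hab : f ∘ₗ a = π ∘ₗ b := LinearMap.ext fun z => z.2
  have hb : Function.Surjective (adicMap I b) := by
    apply surjective_adicMap
    intro p
    obtain ⟨x, hx⟩ := hf (π p)
    have : (I • ⊤ : Submodule A Y) = (I • ⊤ : Submodule A F).map π := by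
      rw [Submodule.map_smul'', Submodule.map_top, LinearMap.range_eq_top.2 hπ]
    rw [this] at hx
    obtain ⟨q, hq, e⟩ := hx
    have hz : f x = π (p - q) := by rw [map_sub, e, sub_sub_cancel]
    refine ⟨⟨(x, p - q), hz⟩, ?_⟩
    change p - (p - q) ∈ _
    rwa [sub_sub_cancel]
  have hLb : Function.Surjective (L0map I b) := by
    have h : Function.Surjective (adicMap I b ∘ₗ L0counit I Z) :=
      hb.comp (surjective_L0counit I Z)
    rw [← L0counit_natural] at h
    exact Function.Surjective.of_comp_left (f := L0counit I F) h
      (bijective_L0counit_of_projective I F).1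
  have h : Function.Surjective (L0map I f ∘ₗ L0map I a) := by
    rw [← L0map_comp, hab, L0map_comp]
    exact hLπ.comp hLb
  exact Function.Surjective.of_comp h

theorem adicCompletion_mem_smul_iff (hI : I.FG) (k : ℕ) (x : AdicCompletion I X) :
    x ∈ (I ^ k • ⊤ : Submodule A (AdicCompletion I X)) ↔ AdicCompletion.eval I X k x = 0 := by
  rw [AdicCompletion.pow_smul_top_eq_ker_eval hI]
  rfl

/-- For the `I`-adic topology on `C^I(X)`, which for finitely generated `I` is that of the kernels
of the projections to `X / I ^ k X`, the image of `X` is dense. -/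
theorem exists_sub_of_mem (hI : I.FG) (k : ℕ) (x : AdicCompletion I X) :
    ∃ y : X, x - AdicCompletion.of I X y ∈ (I ^ k • ⊤ : Submodule A (AdicCompletion I X)) := by
  obtain ⟨y, hy⟩ := Submodule.Quotient.mk_surjective _ (AdicCompletion.eval I X k x)
  refine ⟨y, (adicCompletion_mem_smul_iff hI k _).2 ?_⟩
  rw [map_sub, ← hy]
  exact sub_self _

theorem map_mem_smul_top {J : Ideal A} (f : X →ₗ[A] Y) {x : X} (hx : x ∈ (J • ⊤ : Submodule A X)) :
    f x ∈ (J • ⊤ : Submodule A Y) := by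
  have h := Submodule.mem_map_of_mem (f := f) hx
  rw [Submodule.map_smul''] at h
  exact Submodule.smul_mono le_rfl le_top h

theorem transitionMap_eval {m n : ℕ} (hmn : m ≤ n) (x : AdicCompletion I X) :
    AdicCompletion.transitionMap I X hmn (AdicCompletion.eval I X n x) =
      AdicCompletion.eval I X m x :=
  LinearMap.congr_fun (AdicCompletion.transitionMap_comp_eval I X hmn) x

theorem eval_eq_zero_of_mem (k : ℕ) {x : AdicCompletion I X}
    (hx : x ∈ (I ^ k • ⊤ : Submodule A (AdicCompletion I X))) :
    AdicCompletion.eval I X k x = 0 :=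
  AdicCompletion.pow_smul_top_le_ker_eval I k hx

theorem adicCompletion_hom_ext (hI : I.FG) {u v : AdicCompletion I X →ₗ[A] AdicCompletion I Y}
    (h : u ∘ₗ AdicCompletion.of I X = v ∘ₗ AdicCompletion.of I X) : u = v := by
  apply LinearMap.ext
  intro x
  apply AdicCompletion.ext
  intro k
  change AdicCompletion.eval I Y k (u x) = AdicCompletion.eval I Y k (v x)
  obtain ⟨y, hy⟩ := exists_sub_of_mem hI k x
  have e := eval_eq_zero_of_mem k (map_mem_smul_top (u - v) hy)
  have h' := LinearMap.congr_fun h y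
  rw [LinearMap.comp_apply, LinearMap.comp_apply] at h'
  rw [map_sub, LinearMap.sub_apply (f := u) (g := v) (x := AdicCompletion.of I X y), h', sub_self,
    sub_zero, LinearMap.sub_apply, map_sub, sub_eq_zero] at e
  exact e

/-- A map from `L_0 X` to a completion is determined by its restriction to `X`. -/
theorem L0_hom_ext (hI : I.FG) {u v : L0 I X →ₗ[A] AdicCompletion I Y}
    (h : u ∘ₗ L0unit I X = v ∘ₗ L0unit I X) : u = v := by
  obtain ⟨F, _, π, hπ, hLπ⟩ := exists_projective_surjective_L0map I X
  let ε := LinearEquiv.ofBijective (L0counit I F) (bijective_L0counit_of_projective I F)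
  have hε : ε.symm.toLinearMap ∘ₗ AdicCompletion.of I F = L0unit I F := by
    ext1 x
    apply ε.injective
    rw [LinearMap.comp_apply]
    refine (ε.apply_symm_apply _).trans ?_
    exact (LinearMap.congr_fun (L0counit_comp_L0unit I (M := F)) x).symm
  have key : u ∘ₗ L0map I π ∘ₗ ε.symm.toLinearMap = v ∘ₗ L0map I π ∘ₗ ε.symm.toLinearMap := by
    apply adicCompletion_hom_ext hI
    simp only [LinearMap.comp_assoc]
    rw [hε, L0map_comp_L0unit, ← LinearMap.comp_assoc, h, LinearMap.comp_assoc]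
  ext1 x
  obtain ⟨y, rfl⟩ := hLπ x
  have := LinearMap.congr_fun key (ε y)
  simpa using this

/-- The extension of a map `X → C^I(Y)` to `C^I(X)`. -/
noncomputable def adicExtend (f : X →ₗ[A] AdicCompletion I Y) :
    AdicCompletion I X →ₗ[A] AdicCompletion I Y :=
  AdicCompletion.lift I
    (fun k => Submodule.liftQ _ (AdicCompletion.eval I Y k ∘ₗ f)
      (fun _ hx => eval_eq_zero_of_mem k (map_mem_smul_top f hx)) ∘ₗ AdicCompletion.eval I X k)
    (by
      intro m n hmn
      apply LinearMap.ext
      intro x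
      obtain ⟨y, hy⟩ := Submodule.Quotient.mk_surjective _ (AdicCompletion.eval I X n x)
      have hx : AdicCompletion.eval I X m x = Submodule.Quotient.mk y := by
        rw [← transitionMap_eval hmn, ← hy]
        rfl
      simp only [LinearMap.comp_apply]
      rw [hx, ← hy]
      exact transitionMap_eval hmn (f y))

/-- The extension of a map `X → C^I(Y)` to `L_0 X`. -/
noncomputable def L0extend (f : X →ₗ[A] AdicCompletion I Y) : L0 I X →ₗ[A] AdicCompletion I Y :=
  adicExtend f ∘ₗ L0counit I X

theorem L0extend_comp_L0unit (f : X →ₗ[A] AdicCompletion I Y) :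
    L0extend f ∘ₗ L0unit I X = f := by
  unfold L0extend
  rw [LinearMap.comp_assoc, L0counit_comp_L0unit]
  rfl

/-- The map `ε_X` is injective if the kernel `K` of every surjection `F → X` satisfies
`K ∩ I ^ k F = I ^ k K` for all `k`, which expresses that `Tor_1(A / I ^ k, X) = 0`.  In this case
the sequence `C^I(K) → C^I(F) → C^I(X)` is exact in the middle, and for projective `F` the image of
`C^I(K)` in `L_0 F = C^I(F)` comes from `L_0 K`, so it vanishes in `L_0 X`. -/
theorem injective_L0counit
    (hX : ∀ (F : Type u) [AddCommGroup F] [Module A F] (π : F →ₗ[A] X), Function.Surjective π →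
      ∀ (k : ℕ) (x : LinearMap.ker π), (x : F) ∈ (I ^ k • ⊤ : Submodule A F) →
        x ∈ (I ^ k • ⊤ : Submodule A (LinearMap.ker π))) :
    Function.Injective (L0counit I X) := by
  obtain ⟨F, _, π, hπ, hLπ⟩ := exists_projective_surjective_L0map I X
  rw [injective_iff_map_eq_zero]
  intro x hx
  obtain ⟨y, rfl⟩ := hLπ x
  let K := LinearMap.ker π
  have hy : adicMap I π (L0counit I F y) = 0 := by
    have := LinearMap.congr_fun (L0counit_natural I π) y
    rw [LinearMap.comp_apply, hx] at this
    exact this.symm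
  -- The components of `ε y` lift to `K / I ^ k K`, and uniquely, so the lifts form an element of
  -- `C^I(K)`.
  have hz : ∃ z : AdicCompletion I K, adicMap I K.subtype z = L0counit I F y := by
    have h1 : ∀ k, ∃ z : K, (Submodule.Quotient.mk (z : F) : F ⧸ (I ^ k • ⊤ : Submodule A F)) =
        AdicCompletion.eval I F k (L0counit I F y) := by
      intro k
      obtain ⟨w, hw⟩ := Submodule.Quotient.mk_surjective _
        (AdicCompletion.eval I F k (L0counit I F y))
      have h2 : AdicCompletion.eval I X k (adicMap I π (L0counit I F y)) = 0 := by
        rw [hy, map_zero]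
      rw [eval_adicMap, ← hw, Submodule.mapQ_apply, Submodule.Quotient.mk_eq_zero] at h2
      have : (I ^ k • ⊤ : Submodule A X) = (I ^ k • ⊤ : Submodule A F).map π := by
        rw [Submodule.map_smul'', Submodule.map_top, LinearMap.range_eq_top.2 hπ]
      rw [this] at h2
      obtain ⟨q, hq, e⟩ := h2
      refine ⟨⟨w - q, by rw [LinearMap.mem_ker, map_sub, e, sub_self]⟩, ?_⟩
      rw [← hw, Submodule.Quotient.eq]
      change w - q - w ∈ _
      rw [sub_sub_cancel_left]
      exact neg_mem hq
    choose z hz using h1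
    refine ⟨⟨fun k => Submodule.Quotient.mk (z k), ?_⟩, ?_⟩
    · intro m n hmn
      change (Submodule.Quotient.mk (z n) : K ⧸ (I ^ m • ⊤ : Submodule A K)) =
        Submodule.Quotient.mk (z m)
      rw [Submodule.Quotient.eq]
      apply hX F π hπ m
      change (z n : F) - (z m : F) ∈ _
      rw [← Submodule.Quotient.eq, hz m]
      rw [← transitionMap_eval hmn, ← hz n]
      rfl
    · apply AdicCompletion.ext
      intro k
      exact hz k
  obtain ⟨z, hz⟩ := hz
  obtain ⟨w, rfl⟩ := surjective_L0counit I K z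
  have e : L0map I K.subtype w = y := by
    apply (bijective_L0counit_of_projective I F).1
    rw [← hz]
    exact LinearMap.congr_fun (L0counit_natural I K.subtype) w
  rw [← e, ← LinearMap.comp_apply, ← L0map_comp, LinearMap.comp_ker_subtype, L0map_zero,
    LinearMap.zero_apply]

/-- The multiplication `J ⊗ X → X`. -/
noncomputable def idealMul (J : Ideal A) (X : Type u) [AddCommGroup X] [Module A X] :
    J ⊗[A] X →ₗ[A] X :=
  TensorProduct.lift ((LinearMap.lsmul A X) ∘ₗ J.subtype)

theorem idealMul_natural (J : Ideal A) (f : X →ₗ[A] Y) :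
    idealMul J Y ∘ₗ f.lTensor J = f ∘ₗ idealMul J X :=
  TensorProduct.ext' fun a x => (map_smul f (a : A) x).symm

theorem idealMul_eq (J : Ideal A) (X : Type u) [AddCommGroup X] [Module A X] :
    idealMul J X = (TensorProduct.lid A X).toLinearMap ∘ₗ J.subtype.rTensor X :=
  TensorProduct.ext' fun _ _ => rfl

theorem injective_idealMul_of_flat (J : Ideal A) (X : Type u) [AddCommGroup X] [Module A X]
    [Module.Flat A X] : Function.Injective (idealMul J X) := by
  rw [idealMul_eq]
  exact (TensorProduct.lid A X).injective.comp
    (Module.Flat.rTensor_preserves_injective_linearMap _ J.injective_subtype)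

theorem range_idealMul (J : Ideal A) (X : Type u) [AddCommGroup X] [Module A X] :
    LinearMap.range (idealMul J X) = (J • ⊤ : Submodule A X) := by
  apply le_antisymm
  · rintro _ ⟨t, rfl⟩
    induction t using TensorProduct.induction_on with
    | zero => rw [map_zero]; exact zero_mem _
    | tmul a n => exact Submodule.smul_mem_smul a.2 (Submodule.mem_top (x := n))
    | add s t hs ht => rw [map_add]; exact add_mem hs ht
  · rw [Submodule.smul_le]
    intro a ha n _
    exact ⟨(⟨a, ha⟩ : J) ⊗ₜ n, rfl⟩

/-- If `J ⊗ X → X` is injective, that is `Tor_1(A / J, X) = 0`, then the kernel `K` of every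
surjection `F → X` satisfies `K ∩ J F = J K`. -/
theorem mem_smul_top_ker {J : Ideal A} (hX : Function.Injective (idealMul J X))
    {F : Type u} [AddCommGroup F] [Module A F] {π : F →ₗ[A] X} (hπ : Function.Surjective π)
    (x : LinearMap.ker π) (hx : (x : F) ∈ (J • ⊤ : Submodule A F)) :
    x ∈ (J • ⊤ : Submodule A (LinearMap.ker π)) := by
  rw [← range_idealMul] at hx ⊢
  obtain ⟨t, ht⟩ := hx
  have h0 : π.lTensor J t = 0 := by
    apply hX
    have h := LinearMap.congr_fun (idealMul_natural J π) t
    rw [LinearMap.comp_apply, LinearMap.comp_apply, ht, LinearMap.mem_ker.1 x.2] at h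
    rw [map_zero]
    exact h
  obtain ⟨s, rfl⟩ := (lTensor_exact J (LinearMap.exact_subtype_ker_map π) hπ t).1 h0
  refine ⟨s, Subtype.ext ?_⟩
  rw [← ht]
  exact (LinearMap.congr_fun (idealMul_natural J (LinearMap.ker π).subtype) s).symm

/-- If some flat module `F` maps onto `X` with kernel `K` such that `K ∩ J F = J K`, then
`J ⊗ X → X` is injective. -/
theorem injective_idealMul {J : Ideal A} {F : Type u} [AddCommGroup F] [Module A F]
    [Module.Flat A F] {π : F →ₗ[A] X} (hπ : Function.Surjective π)
    (h : ∀ x : LinearMap.ker π, (x : F) ∈ (J • ⊤ : Submodule A F) →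
      x ∈ (J • ⊤ : Submodule A (LinearMap.ker π))) :
    Function.Injective (idealMul J X) := by
  rw [injective_iff_map_eq_zero]
  intro t ht
  obtain ⟨s, rfl⟩ := LinearMap.lTensor_surjective J hπ t
  have h0 : π (idealMul J F s) = 0 :=
    (LinearMap.congr_fun (idealMul_natural J π) s).symm.trans ht
  have h1 : idealMul J F s ∈ (J • ⊤ : Submodule A F) := by
    rw [← range_idealMul]
    exact ⟨s, rfl⟩
  have h2 := h ⟨idealMul J F s, h0⟩ h1
  rw [← range_idealMul] at h2
  obtain ⟨r, hr⟩ := h2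
  have h3 : (LinearMap.ker π).subtype.lTensor J r = s := by
    apply injective_idealMul_of_flat J F
    have := LinearMap.congr_fun (idealMul_natural J (LinearMap.ker π).subtype) r
    rw [LinearMap.comp_apply, LinearMap.comp_apply, hr] at this
    exact this
  rw [← h3]
  exact (lTensor_exact J (LinearMap.exact_subtype_ker_map π) hπ _).2 ⟨r, rfl⟩

end LCompletion

/-! ### Flat Hopf algebroids -/

theorem LinearMap.exists_comp_eq_of_range_le {A : Type u} [CommRing A] {X Y Z : Type u}
    [AddCommGroup X] [Module A X] [AddCommGroup Y] [Module A Y] [AddCommGroup Z] [Module A Z]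
    {j : X →ₗ[A] Y} (hj : Function.Injective j) {f : Z →ₗ[A] Y} (h : ∀ z, ∃ x, j x = f z) :
    ∃ g : Z →ₗ[A] X, j ∘ₗ g = f := by
  let f' : Z →ₗ[A] LinearMap.range j := f.codRestrict _ h
  refine ⟨(LinearEquiv.ofInjective j hj).symm.toLinearMap ∘ₗ f', LinearMap.ext fun z => ?_⟩
  exact congrArg Subtype.val ((LinearEquiv.ofInjective j hj).apply_symm_apply (f' z))

namespace HopfAlgebroidData

variable {A Ψ : Type u} [CommRing A] [CommRing Ψ] (H : HopfAlgebroidData A Ψ)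
variable {M N P : Type u} [AddCommGroup M] [Module A M] [AddCommGroup N] [Module A N]
  [AddCommGroup P] [Module A P]

/-- The conjugation interchanges the units, so left flatness is right flatness. -/
instance flat_right [Module.Flat A (Via H.ηL)] : Module.Flat A (Via H.ηR) := by
  let e : Via H.ηR ≃ₗ[A] Via H.ηL :=
    { toFun := H.c
      invFun := H.c
      left_inv := H.c_c
      right_inv := H.c_c
      map_add' := map_add H.c
      map_smul' := fun a x => by
        refine (congrArg H.c (Algebra.smul_def a x)).trans ?_
        exact (map_mul H.c _ _).trans (congrArg (· * _) (H.c_ηR a)) }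
  exact Module.Flat.of_linearEquiv e

instance flat_tens [Module.Flat A (Via H.ηL)] [Module.Flat A N] : Module.Flat A (H.Tens N) := by
  let _ : Module (Via H.ηL) (H.Tens N) := inferInstanceAs (Module Ψ (H.Tens N))
  have : IsScalarTower A (Via H.ηL) (H.Tens N) := ⟨fun a x t => by
    rw [Algebra.smul_def, mul_smul]; rfl⟩
  have : Module.Flat (Via H.ηL) (H.Tens N) :=
    inferInstanceAs (Module.Flat (Via H.ηR) (Via H.ηR ⊗[A] N))
  exact Module.Flat.trans A (Via H.ηL) (H.Tens N)

theorem tensMap_id : H.tensMap (LinearMap.id : M →ₗ[A] M) = LinearMap.id :=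
  H.tens_hom_ext fun _ _ => rfl

theorem tensMap_comp_apply (g : N →ₗ[A] P) (f : M →ₗ[A] N) (t : H.Tens M) :
    H.tensMap (g ∘ₗ f) t = H.tensMap g (H.tensMap f t) :=
  LinearMap.congr_fun (H.tensMap_comp g f) t

theorem tensMap_injective [Module.Flat A (Via H.ηL)] {f : M →ₗ[A] N} (hf : Function.Injective f) :
    Function.Injective (H.tensMap f) :=
  Module.Flat.lTensor_preserves_injective_linearMap (M := Via H.ηR) f hf

theorem tensMap_surjective {f : M →ₗ[A] N} (hf : Function.Surjective f) :
    Function.Surjective (H.tensMap f) :=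
  LinearMap.lTensor_surjective (Via H.ηR) hf

theorem tensMap_exact [Module.Flat A (Via H.ηL)] {f : M →ₗ[A] N} {g : N →ₗ[A] P}
    (h : Function.Exact f g) : Function.Exact (H.tensMap f) (H.tensMap g) :=
  Module.Flat.lTensor_exact (Via H.ηR) h

variable {H} {I : Ideal A}

theorem quotComparison_mkQ (hI : H.IsInvariant I) (k : ℕ) (t : H.Tens M) :
    quotComparison hI k M (H.tensMap (Submodule.mkQ _) t) = Submodule.Quotient.mk t :=
  LinearMap.congr_fun (show quotComparison hI k M ∘ₗ H.tensMap (Submodule.mkQ _) =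
    Submodule.mkQ _ from H.tens_hom_ext fun _ _ => rfl) t

theorem tensMap_mkQ_eq_zero (hI : H.IsInvariant I) (k : ℕ) {t : H.Tens M}
    (ht : t ∈ (I ^ k • ⊤ : Submodule A (H.Tens M))) :
    H.tensMap (Submodule.mkQ (I ^ k • ⊤ : Submodule A M)) t = 0 := by
  have : (I ^ k • ⊤ : Submodule A (H.Tens M)) ≤
      LinearMap.ker (H.tensMap (Submodule.mkQ (I ^ k • ⊤ : Submodule A M))) := by
    rw [Submodule.smul_le]
    intro a ha s _
    rw [LinearMap.mem_ker, map_smul, H.smul_eq]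
    exact smul_tens_quot_eq_zero hI k (Ideal.mem_map_of_mem _ ha) _
  exact this ht

theorem quotComparison_injective (hI : H.IsInvariant I) (k : ℕ) :
    Function.Injective (quotComparison hI k M) := by
  rw [injective_iff_map_eq_zero]
  intro s hs
  obtain ⟨t, rfl⟩ := H.tensMap_surjective (Submodule.mkQ_surjective _) s
  rw [quotComparison_mkQ, Submodule.Quotient.mk_eq_zero] at hs
  exact tensMap_mkQ_eq_zero hI k hs

/-- `Tor_1(A / I ^ k, Ψ ⊗ M) = Ψ ⊗ Tor_1(A / I ^ k, M)` for a flat Hopf algebroid and an invariant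
ideal `I`, in the case where the right hand side vanishes. -/
theorem injective_idealMul_tens [Module.Flat A (Via H.ηL)] (hI : H.IsInvariant I) (k : ℕ)
    (hM : Function.Injective (idealMul (I ^ k) M)) :
    Function.Injective (idealMul (I ^ k) (H.Tens M)) := by
  obtain ⟨F, _, _, _, π, hπ⟩ : ∃ (F : Type u) (_ : AddCommGroup F) (_ : Module A F)
      (_ : Module.Flat A F) (π : F →ₗ[A] M), Function.Surjective π :=
    ⟨M →₀ A, inferInstance, inferInstance, inferInstance, _,
      Finsupp.linearCombination_id_surjective A M⟩
  let K := LinearMap.ker π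
  have hex := H.tensMap_exact (LinearMap.exact_subtype_ker_map π)
  apply injective_idealMul (H.tensMap_surjective hπ)
  intro x hx
  obtain ⟨t, ht⟩ := (hex x).1 x.2
  -- `K / I ^ k K → F / I ^ k F` is injective, and remains so after tensoring with `Ψ`.
  let q : (K ⧸ (I ^ k • ⊤ : Submodule A K)) →ₗ[A] F ⧸ (I ^ k • ⊤ : Submodule A F) :=
    Submodule.mapQ _ _ K.subtype (fun _ h => map_mem_smul_top K.subtype h)
  have hq : Function.Injective q := by
    rw [injective_iff_map_eq_zero]
    intro y hy
    obtain ⟨y, rfl⟩ := Submodule.Quotient.mk_surjective _ y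
    rw [Submodule.mapQ_apply, Submodule.Quotient.mk_eq_zero] at hy
    exact (Submodule.Quotient.mk_eq_zero _).2 (mem_smul_top_ker hM hπ y hy)
  have h0 : H.tensMap (Submodule.mkQ (I ^ k • ⊤ : Submodule A K)) t = 0 := by
    apply H.tensMap_injective hq
    rw [← tensMap_comp_apply, map_zero]
    have : q ∘ₗ Submodule.mkQ _ = Submodule.mkQ _ ∘ₗ K.subtype := rfl
    rw [this, tensMap_comp_apply, ht]
    exact tensMap_mkQ_eq_zero hI k hx
  have h1 : t ∈ (I ^ k • ⊤ : Submodule A (H.Tens K)) := by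
    rw [← Submodule.Quotient.mk_eq_zero, ← quotComparison_mkQ hI, h0, map_zero]
  let r : H.Tens K →ₗ[A] LinearMap.ker (H.tensMap π) :=
    (H.tensMap K.subtype).codRestrict _ fun s => (hex _).2 ⟨s, rfl⟩
  have h2 : r t = x := Subtype.ext ht
  rw [← h2]
  exact map_mem_smul_top r h1

/-! ### Comodules -/

theorem counitTens_tensMap (f : M →ₗ[A] N) (t : H.Tens M) :
    H.counitTens N (H.tensMap f t) = f (H.counitTens M t) :=
  LinearMap.congr_fun (H.counitTens_natural f) t

theorem comulTens_tensMap (f : M →ₗ[A] N) (t : H.Tens M) :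
    H.comulTens N (H.tensMap f t) = H.tensMap (H.tensMap f) (H.comulTens M t) :=
  LinearMap.congr_fun (H.comulTens_natural f) t

theorem counitTens_comul (x : Ψ) : H.counitTens (Via H.ηL) (H.comul x) = x := by
  refine Eq.trans ?_ (H.counit_left x)
  change H.counitTens (Via H.ηL) (H.Δ x) = _
  generalize H.Δ x = t
  induction t using TensorProduct.induction_on with
  | zero => exact (map_zero _).trans (map_zero _).symm
  | tmul y z =>
    refine (H.counitTens_tmul y z).trans ?_
    rw [Algebra.smul_def, Algebra.TensorProduct.productMap_apply_tmul]
    rfl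
  | add s t hs ht =>
    exact (map_add _ _ _).trans ((congrArg₂ (· + ·) hs ht).trans (map_add _ _ _).symm)

namespace Coaction

/-- The coaction of `N` restricts along an injective map `j : X → N` as soon as it maps `X` to the
image of `Ψ ⊗ X`. -/
theorem exists_isHom_of_injective [Module.Flat A (Via H.ηL)] (χ : H.Coaction N) {j : M →ₗ[A] N}
    (hj : Function.Injective j) (h : ∀ x, ∃ t, H.tensMap j t = χ.coact (j x)) :
    ∃ ρ : H.Coaction M, IsHom ρ χ j := by
  obtain ⟨ρ, hρ⟩ := LinearMap.exists_comp_eq_of_range_le (H.tensMap_injective hj)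
    (f := χ.coact ∘ₗ j) h
  have hρ' (x : M) : H.tensMap j (ρ x) = χ.coact (j x) := LinearMap.congr_fun hρ x
  refine ⟨⟨ρ, ?_, ?_⟩, hρ.symm⟩
  · ext x
    apply hj
    rw [LinearMap.comp_apply, ← counitTens_tensMap, hρ']
    exact LinearMap.congr_fun χ.counit (j x)
  · ext x
    apply H.tensMap_injective (H.tensMap_injective hj)
    rw [LinearMap.comp_apply, LinearMap.comp_apply, ← tensMap_comp_apply, hρ, tensMap_comp_apply,
      hρ', ← comulTens_tensMap, hρ']
    exact LinearMap.congr_fun χ.coassoc (j x)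

theorem IsHom.apply {ψ : H.Coaction M} {χ : H.Coaction N} {f : M →ₗ[A] N} (hf : IsHom ψ χ f)
    (x : M) : χ.coact (f x) = H.tensMap f (ψ.coact x) :=
  LinearMap.congr_fun hf x

/-- A map to a subcomodule is a morphism if its composite with the inclusion is one. -/
theorem IsHom.of_comp_injective [Module.Flat A (Via H.ηL)] {ψ : H.Coaction M} {χ : H.Coaction N}
    {ω : H.Coaction P} {f : M →ₗ[A] N} {j : N →ₗ[A] P} (hj : Function.Injective j)
    (hjh : IsHom χ ω j) (h : IsHom ψ ω (j ∘ₗ f)) : IsHom ψ χ f := by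
  refine LinearMap.ext fun x => H.tensMap_injective hj ?_
  have := h.apply x
  rw [LinearMap.comp_apply, hjh.apply, tensMap_comp_apply] at this
  exact this

theorem IsHom.comp {ψ : H.Coaction M} {χ : H.Coaction N}
    {ω : H.Coaction P} {f : M →ₗ[A] N} {g : N →ₗ[A] P} (hg : IsHom χ ω g) (hf : IsHom ψ χ f) :
    IsHom ψ ω (g ∘ₗ f) :=
  LinearMap.ext fun x => by
    rw [LinearMap.comp_apply, LinearMap.comp_apply, hg.apply, hf.apply, LinearMap.comp_apply,
      tensMap_comp_apply]

variable (H) in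
/-- The unit comodule `A`, with coaction `ηL`. -/
noncomputable def unit : H.Coaction A where
  coact := LinearMap.toSpanSingleton A _ (H.tmul 1 1)
  counit := by
    ext
    simp [counitTens_tmul]
  coassoc := by
    ext
    simp only [LinearMap.comp_apply, LinearMap.toSpanSingleton_apply, one_smul, tensMap_tmul,
      comulTens_tmul]
    have : H.comul (1 : Ψ) = H.tmul (M := Via H.ηL) 1 (1 : Ψ) := map_one H.Δ
    rw [this]
    rfl

theorem unit_coact (a : A) : (unit H).coact a = H.tmul (H.ηL a) 1 := by
  change a • H.tmul 1 (1 : A) = _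
  rw [H.smul_eq, H.smul_tmul, mul_one]

/-- An invariant ideal is a subcomodule of `A`. -/
theorem exists_isHom_subtype [Module.Flat A (Via H.ηL)] {J : Ideal A} (hJ : H.IsInvariant J) :
    ∃ ρ : H.Coaction J, IsHom ρ (unit H) J.subtype := by
  apply exists_isHom_of_injective _ J.injective_subtype
  intro a
  rw [unit_coact]
  have ha : H.ηL (J.subtype a) ∈ J.map H.ηR := hJ ▸ Ideal.mem_map_of_mem _ a.2
  generalize H.ηL (J.subtype a) = x at ha
  induction ha using Submodule.span_induction with
  | mem x h =>
    obtain ⟨b, hb, rfl⟩ := h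
    refine ⟨H.tmul 1 ⟨b, hb⟩, ?_⟩
    rw [tensMap_tmul]
    have := H.tmul_smul 1 b (1 : A)
    rw [smul_eq_mul, mul_one, one_mul] at this
    exact this
  | zero => exact ⟨0, (map_zero _).trans (TensorProduct.zero_tmul _ _).symm⟩
  | add x y _ _ hx hy =>
    obtain ⟨s, hs⟩ := hx
    obtain ⟨t, ht⟩ := hy
    exact ⟨s + t, by rw [map_add, hs, ht, H.add_tmul]⟩
  | smul y x _ hx =>
    obtain ⟨s, hs⟩ := hx
    exact ⟨y • s, by rw [tensMap_smul, hs, H.smul_tmul, smul_eq_mul]⟩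

/-- `Tor_1(A / I ^ k, M) = 0` for a flat comodule `M`, because `0 → I ^ k → A → A / I ^ k → 0` is an
exact sequence of comodules. -/
theorem IsFlat.injective_idealMul [Module.Flat A (Via H.ηL)] (hI : H.IsInvariant I)
    {ψ : H.Coaction M} (hM : ψ.IsFlat) (k : ℕ) : Function.Injective (idealMul (I ^ k) M) := by
  obtain ⟨ρ, hρ⟩ := exists_isHom_subtype (hI.pow k)
  have hq : IsHom (unit H) ((unit H).quot hI k) (Submodule.mkQ _) := Submodule.liftQ_mkQ _ _ _
  have hex : Function.Exact (I ^ k : Ideal A).subtype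
      (Submodule.mkQ (I ^ k • ⊤ : Submodule A A)) := by
    intro a
    rw [Submodule.mkQ_apply, Submodule.Quotient.mk_eq_zero, smul_eq_mul, Ideal.mul_top]
    exact ⟨fun h => ⟨⟨a, h⟩, rfl⟩, by rintro ⟨b, rfl⟩; exact b.2⟩
  have h := (hM _ _ _ ρ (unit H) _ _ _ hρ hq (I ^ k : Ideal A).injective_subtype hex
    (Submodule.mkQ_surjective _)).1
  have e : idealMul (I ^ k) M = (TensorProduct.rid A M).toLinearMap ∘ₗ
      (I ^ k : Ideal A).subtype.lTensor M ∘ₗ (TensorProduct.comm A _ M).toLinearMap :=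
    TensorProduct.ext' fun _ _ => rfl
  rw [e]
  exact (TensorProduct.rid A M).injective.comp
    (h.comp (TensorProduct.comm A (I ^ k : Ideal A) M).injective)

end Coaction

end HopfAlgebroidData

/-- The extended comodule `Ψ ⊗ N`, with coaction `Δ ⊗ 1`. -/
noncomputable def HopfAlgebroid.extended {A Ψ : Type u} [CommRing A] [CommRing Ψ]
    (H : HopfAlgebroid A Ψ) (N : Type u) [AddCommGroup N] [Module A N] :
    H.Coaction (H.Tens N) where
  coact := H.comulTens N
  counit := H.tens_hom_ext fun x n => by
    rw [LinearMap.comp_apply, H.comulTens_tmul, HopfAlgebroidData.counitTens_tensMap,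
      HopfAlgebroidData.counitTens_comul]
    rfl
  coassoc := H.tens_hom_ext fun x n => by
    have h : H.comulTens N ∘ₗ H.tmulRight n = H.tensMap (H.tmulRight n) ∘ₗ H.comul := rfl
    have hc : H.tensMap H.comul (H.comul x) = H.comulTens _ (H.comul x) :=
      LinearMap.congr_fun H.coassoc x
    rw [LinearMap.comp_apply, LinearMap.comp_apply, H.comulTens_tmul,
      HopfAlgebroidData.comulTens_tensMap, ← HopfAlgebroidData.tensMap_comp_apply, h,
      HopfAlgebroidData.tensMap_comp_apply]
    exact congrArg _ hc

namespace HopfAlgebroidData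

variable {A Ψ : Type u} [CommRing A] [CommRing Ψ] {H : HopfAlgebroidData A Ψ} {I : Ideal A}
variable {M N : Type u} [AddCommGroup M] [Module A M] [AddCommGroup N] [Module A N]

/-! ### The comparison map `Ψ ⊗ C^I(M) → C^I(Ψ ⊗ M)` -/

theorem tens_adic_hom_ext {f g : H.Tens (AdicCompletion I M) →ₗ[A] AdicCompletion I N}
    (h : ∀ x y k, AdicCompletion.eval I N k (f (H.tmul x y)) =
      AdicCompletion.eval I N k (g (H.tmul x y))) : f = g :=
  H.tens_hom_ext fun x y => AdicCompletion.ext fun k => h x y k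

theorem eval_adicMap_of_eq (f : M →ₗ[A] N) {k : ℕ} {x : AdicCompletion I M} {m : M}
    (h : AdicCompletion.eval I M k x = Submodule.Quotient.mk m) :
    AdicCompletion.eval I N k (adicMap I f x) = Submodule.Quotient.mk (f m) := by
  rw [eval_adicMap, h, Submodule.mapQ_apply]

theorem eval_adicComparison_tmul_of_eq (hI : H.IsInvariant I) (x : Ψ) {k : ℕ}
    {y : AdicCompletion I M} {m : M} (h : AdicCompletion.eval I M k y = Submodule.Quotient.mk m) :
    AdicCompletion.eval I (H.Tens M) k (adicComparison hI M (H.tmul x y)) =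
      Submodule.Quotient.mk (H.tmul x m) := by
  rw [eval_adicComparison, tensMap_tmul, h, quotComparison_tmul]

theorem adicComparison_tensMap_of (hI : H.IsInvariant I) (t : H.Tens M) :
    adicComparison hI M (H.tensMap (AdicCompletion.of I M) t) =
      AdicCompletion.of I (H.Tens M) t := by
  refine LinearMap.congr_fun (f := adicComparison hI M ∘ₗ H.tensMap (AdicCompletion.of I M)) ?_ t
  exact H.tens_hom_ext fun x m => AdicCompletion.ext fun k => rfl

theorem adicComparison_tensMap_adicMap (hI : H.IsInvariant I) (f : M →ₗ[A] N)
    (t : H.Tens (AdicCompletion I M)) :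
    adicComparison hI N (H.tensMap (adicMap I f) t) =
      adicMap I (H.tensMap f) (adicComparison hI M t) := by
  refine LinearMap.congr_fun (f := adicComparison hI N ∘ₗ H.tensMap (adicMap I f))
    (g := adicMap I (H.tensMap f) ∘ₗ adicComparison hI M) ?_ t
  apply tens_adic_hom_ext
  intro x y k
  obtain ⟨m, hm⟩ := Submodule.Quotient.mk_surjective _ (AdicCompletion.eval I M k y)
  rw [LinearMap.comp_apply, LinearMap.comp_apply, tensMap_tmul,
    eval_adicComparison_tmul_of_eq hI x (eval_adicMap_of_eq f hm.symm),
    eval_adicMap_of_eq _ (eval_adicComparison_tmul_of_eq hI x hm.symm), tensMap_tmul]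

theorem adicMap_counitTens_adicComparison (hI : H.IsInvariant I)
    (t : H.Tens (AdicCompletion I M)) :
    adicMap I (H.counitTens M) (adicComparison hI M t) =
      H.counitTens (AdicCompletion I M) t := by
  refine LinearMap.congr_fun (f := adicMap I (H.counitTens M) ∘ₗ adicComparison hI M) ?_ t
  apply tens_adic_hom_ext
  intro x y k
  obtain ⟨m, hm⟩ := Submodule.Quotient.mk_surjective _ (AdicCompletion.eval I M k y)
  rw [LinearMap.comp_apply, counitTens_tmul, map_smul, ← hm,
    eval_adicMap_of_eq _ (eval_adicComparison_tmul_of_eq hI x hm.symm), counitTens_tmul,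
    Submodule.Quotient.mk_smul]

/-- The comparison map is compatible with the diagonal. -/
theorem adicMap_comulTens_adicComparison (hI : H.IsInvariant I)
    (t : H.Tens (AdicCompletion I M)) :
    adicMap I (H.comulTens M) (adicComparison hI M t) =
      adicComparison hI (H.Tens M)
        (H.tensMap (adicComparison hI M) (H.comulTens (AdicCompletion I M) t)) := by
  refine LinearMap.congr_fun (f := adicMap I (H.comulTens M) ∘ₗ adicComparison hI M)
    (g := adicComparison hI (H.Tens M) ∘ₗ H.tensMap (adicComparison hI M) ∘ₗ
      H.comulTens (AdicCompletion I M)) ?_ t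
  apply tens_adic_hom_ext
  intro x y k
  obtain ⟨m, hm⟩ := Submodule.Quotient.mk_surjective _ (AdicCompletion.eval I M k y)
  rw [LinearMap.comp_apply, LinearMap.comp_apply, LinearMap.comp_apply,
    eval_adicMap_of_eq _ (eval_adicComparison_tmul_of_eq hI x hm.symm), comulTens_tmul,
    comulTens_tmul, eval_adicComparison, ← tensMap_comp_apply, ← tensMap_comp_apply]
  have h : AdicCompletion.eval I (H.Tens M) k ∘ₗ adicComparison hI M ∘ₗ H.tmulRight y =
      Submodule.mkQ _ ∘ₗ H.tmulRight m :=
    LinearMap.ext fun z => eval_adicComparison_tmul_of_eq hI z hm.symm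
  rw [LinearMap.comp_assoc, h, tensMap_comp_apply, quotComparison_mkQ]

theorem adicMap_comp_apply {P : Type u} [AddCommGroup P] [Module A P] (g : N →ₗ[A] P)
    (f : M →ₗ[A] N) (x : AdicCompletion I M) :
    adicMap I g (adicMap I f x) = adicMap I (g ∘ₗ f) x :=
  (LinearMap.congr_fun (adicMap_comp g f) x).symm

/-! ### The comodule `C^I_Ψ(M)` -/

namespace Coaction

variable (hI : H.IsInvariant I) (ψ : H.Coaction M)

theorem CPsi.condition (x : ψ.CPsi hI) :
    adicMap I ψ.coact (CPsi.i hI ψ x) = adicComparison hI M (CPsi.p hI ψ x) :=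
  x.2

/-- The first projection is determined by the second one. -/
theorem CPsi.counitTens_p (x : ψ.CPsi hI) :
    H.counitTens _ (CPsi.p hI ψ x) = CPsi.i hI ψ x := by
  rw [← adicMap_counitTens_adicComparison hI, ← CPsi.condition, adicMap_comp_apply, ψ.counit,
    adicMap_id]
  rfl

theorem CPsi.p_injective : Function.Injective (CPsi.p hI ψ) := by
  intro x y h
  have h' : CPsi.i hI ψ x = CPsi.i hI ψ y := by rw [← CPsi.counitTens_p, h, CPsi.counitTens_p]
  exact Subtype.ext (Prod.ext h' h)

/-- A comodule `X` with a map `h : X → C^I(M)` that is compatible with the coactions maps to the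
pullback `C^I_Ψ(M)`. -/
theorem CPsi.exists_lift {X : Type u} [AddCommGroup X] [Module A X] (χ : H.Coaction X)
    (h : X →ₗ[A] AdicCompletion I M)
    (hh : ∀ x, adicMap I ψ.coact (h x) = adicComparison hI M (H.tensMap h (χ.coact x))) :
    ∃ g : X →ₗ[A] ψ.CPsi hI, CPsi.i hI ψ ∘ₗ g = h ∧
      CPsi.p hI ψ ∘ₗ g = H.tensMap h ∘ₗ χ.coact :=
  ⟨LinearMap.codRestrict _ (LinearMap.prod h (H.tensMap h ∘ₗ χ.coact)) hh, rfl, rfl⟩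

/-- The value at `x` of the coaction on `C^I_Ψ(M)`.  Since `Ψ` is flat, `Ψ ⊗ C^I_Ψ(M)` is again a
pullback, and `(p, (Δ ⊗ 1) p)` is a point of it: the two images agree in `Ψ ⊗ C^I(Ψ ⊗ M)`, because
they agree in `C^I(Ψ ⊗ Ψ ⊗ M)`. -/
theorem CPsi.exists_tens [Module.Flat A (Via H.ηL)]
    (hC : Function.Injective (adicComparison hI (H.Tens M))) (x : ψ.CPsi hI) :
    ∃ t : H.Tens (ψ.CPsi hI), H.tensMap (CPsi.i hI ψ) t = CPsi.p hI ψ x ∧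
      H.tensMap (CPsi.p hI ψ) t = H.comulTens _ (CPsi.p hI ψ x) := by
  let D := AdicCompletion I M
  let d : (D × H.Tens D) →ₗ[A] AdicCompletion I (H.Tens M) :=
    adicMap I ψ.coact ∘ₗ LinearMap.fst A _ _ - adicComparison hI M ∘ₗ LinearMap.snd A _ _
  have hd : Function.Exact (ψ.CPsi hI).subtype d := by
    intro z
    change adicMap I ψ.coact z.1 - adicComparison hI M z.2 = 0 ↔ _
    rw [sub_eq_zero]
    exact ⟨fun h => ⟨⟨z, h⟩, rfl⟩, by rintro ⟨w, rfl⟩; exact w.2⟩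
  let y : H.Tens (D × H.Tens D) := H.tensMap (LinearMap.inl A D (H.Tens D)) (CPsi.p hI ψ x) +
    H.tensMap (LinearMap.inr A D (H.Tens D)) (H.comulTens _ (CPsi.p hI ψ x))
  have hl : d ∘ₗ LinearMap.inl A D (H.Tens D) = adicMap I ψ.coact := by
    refine LinearMap.ext fun z => ?_
    simp [d]
  have hr : d ∘ₗ LinearMap.inr A D (H.Tens D) = (adicComparison hI M) ∘ₗ (-LinearMap.id) := by
    refine LinearMap.ext fun z => ?_
    simp [d]
  have hneg (t : H.Tens (H.Tens D)) : H.tensMap (-LinearMap.id) t = -t := by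
    refine LinearMap.congr_fun (g := -LinearMap.id) (H.tens_hom_ext fun x m => ?_) t
    exact TensorProduct.tmul_neg _ _
  have hy : H.tensMap d y = 0 := by
    apply hC
    rw [map_add, ← tensMap_comp_apply, ← tensMap_comp_apply, hl, hr, tensMap_comp_apply, hneg,
      map_neg, map_add, map_neg, adicComparison_tensMap_adicMap, ← CPsi.condition,
      ← adicMap_comulTens_adicComparison, ← CPsi.condition, adicMap_comp_apply,
      adicMap_comp_apply, ψ.coassoc, map_zero]
    exact add_neg_cancel _
  obtain ⟨t, ht⟩ := (H.tensMap_exact hd y).1 hy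
  have h0 {X Y : Type u} [AddCommGroup X] [Module A X] [AddCommGroup Y] [Module A Y]
      (s : H.Tens X) : H.tensMap (0 : X →ₗ[A] Y) s = 0 := by
    refine LinearMap.congr_fun (g := 0) (H.tens_hom_ext fun x m => ?_) s
    exact TensorProduct.tmul_zero _ _
  refine ⟨t, ?_, ?_⟩
  · unfold CPsi.i
    rw [tensMap_comp_apply, ht, map_add, ← tensMap_comp_apply, ← tensMap_comp_apply,
      LinearMap.fst_comp_inl, LinearMap.fst_comp_inr, tensMap_id, h0, add_zero]
    rfl
  · unfold CPsi.p
    rw [tensMap_comp_apply, ht, map_add, ← tensMap_comp_apply, ← tensMap_comp_apply,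
      LinearMap.snd_comp_inl, LinearMap.snd_comp_inr, tensMap_id, h0, zero_add]
    rfl

end Coaction

end HopfAlgebroidData

namespace HopfAlgebroid

open HopfAlgebroidData Coaction

variable {A Ψ : Type u} [CommRing A] [CommRing Ψ] {H : HopfAlgebroid A Ψ} {I : Ideal A}
variable {M : Type u} [AddCommGroup M] [Module A M]

/-- `C^I_Ψ(M)` is a subcomodule of the extended comodule `Ψ ⊗ C^I(M)` by means of `p`. -/
theorem exists_coaction_CPsi [Module.Flat A (Via H.ηL)] (hI : H.IsInvariant I)
    (ψ : H.Coaction M) (hC : Function.Injective (adicComparison hI (H.Tens M))) :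
    ∃ ρ : H.Coaction (ψ.CPsi hI), IsHom ρ (H.extended _) (CPsi.p hI ψ) ∧
      H.tensMap (CPsi.i hI ψ) ∘ₗ ρ.coact = CPsi.p hI ψ := by
  obtain ⟨ρ, hρ⟩ := exists_isHom_of_injective (H.extended (AdicCompletion I M))
    (CPsi.p_injective hI ψ) fun x => (CPsi.exists_tens hI ψ hC x).imp fun t ht => ht.2
  refine ⟨ρ, hρ, LinearMap.ext fun x => ?_⟩
  obtain ⟨t, ht1, ht2⟩ := CPsi.exists_tens hI ψ hC x
  have : ρ.coact x = t := by
    apply H.tensMap_injective (CPsi.p_injective hI ψ)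
    rw [← hρ.apply, ht2]
    rfl
  rw [LinearMap.comp_apply, this, ht1]

variable [Module.Flat A (Via H.ηL)] {hI : H.IsInvariant I} {ψ : H.Coaction M}
  {ρ : H.Coaction (ψ.CPsi hI)}
  {X : Type u} [AddCommGroup X] [Module A X] (χ : H.Coaction X)

/-- The comodule morphisms `X → C^I_Ψ(M)` are the maps `h : X → C^I(M)` that are compatible with the
coactions. -/
theorem existsUnique_hom_CPsi (hρ : IsHom ρ (H.extended _) (CPsi.p hI ψ))
    (hρi : H.tensMap (CPsi.i hI ψ) ∘ₗ ρ.coact = CPsi.p hI ψ)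
    (h : X →ₗ[A] AdicCompletion I M)
    (hh : ∀ x, adicMap I ψ.coact (h x) = adicComparison hI M (H.tensMap h (χ.coact x))) :
    ∃! g : X →ₗ[A] ψ.CPsi hI, IsHom χ ρ g ∧ CPsi.i hI ψ ∘ₗ g = h := by
  obtain ⟨g, hg1, hg2⟩ := CPsi.exists_lift hI ψ χ h hh
  refine ⟨g, ⟨IsHom.of_comp_injective (CPsi.p_injective hI ψ) hρ ?_, hg1⟩, ?_⟩
  · rw [hg2]
    refine LinearMap.ext fun x => ?_
    have hc := LinearMap.congr_fun χ.coassoc x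
    rw [LinearMap.comp_apply, LinearMap.comp_apply] at hc
    rw [LinearMap.comp_apply, LinearMap.comp_apply, LinearMap.comp_apply, tensMap_comp_apply, hc]
    exact comulTens_tensMap h (χ.coact x)
  · rintro g' ⟨h1, h2⟩
    refine LinearMap.ext fun x => CPsi.p_injective hI ψ ?_
    rw [← LinearMap.comp_apply, ← LinearMap.comp_apply (CPsi.p hI ψ), hg2, ← hρi,
      LinearMap.comp_assoc, h1, ← LinearMap.comp_assoc, ← tensMap_comp, h2]

theorem isCompletion_CPsi (hρ : IsHom ρ (H.extended _) (CPsi.p hI ψ))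
    (hρi : H.tensMap (CPsi.i hI ψ) ∘ₗ ρ.coact = CPsi.p hI ψ) :
    ψ.IsCompletion hI ρ (fun k => AdicCompletion.eval I M k ∘ₗ CPsi.i hI ψ) := by
  have hq (k : ℕ) (y : AdicCompletion I M) :
      quotComparison hI k M ((ψ.quot hI k).coact (AdicCompletion.eval I M k y)) =
        AdicCompletion.eval I _ k (adicMap I ψ.coact y) := by
    obtain ⟨m, hm⟩ := Submodule.Quotient.mk_surjective _ (AdicCompletion.eval I M k y)
    rw [eval_adicMap_of_eq _ hm.symm, ← hm, ← quotComparison_mkQ hI]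
    rfl
  refine ⟨fun k => LinearMap.ext fun x => quotComparison_injective hI k ?_, fun k l hkl => ?_,
    fun X _ _ χ f hf hf' => ?_⟩
  · rw [LinearMap.comp_apply, LinearMap.comp_apply, hq, CPsi.condition, eval_adicComparison,
      LinearMap.comp_apply, tensMap_comp_apply]
    exact congrArg (fun t => quotComparison hI k M (H.tensMap (AdicCompletion.eval I M k) t))
      (LinearMap.congr_fun hρi x).symm
  · exact LinearMap.ext fun x => transitionMap_eval hkl (CPsi.i hI ψ x)
  · let h : X →ₗ[A] AdicCompletion I M := AdicCompletion.lift I f fun hle => hf' _ _ hle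
    have he (k : ℕ) : AdicCompletion.eval I M k ∘ₗ h = f k := AdicCompletion.eval_lift I f _ k
    have hg : ∀ g : X →ₗ[A] ψ.CPsi hI, CPsi.i hI ψ ∘ₗ g = h ↔
        ∀ k, (AdicCompletion.eval I M k ∘ₗ CPsi.i hI ψ) ∘ₗ g = f k := by
      refine fun g => ⟨fun e k => by rw [LinearMap.comp_assoc, e, he], fun e => ?_⟩
      refine LinearMap.ext fun x => AdicCompletion.ext fun k => ?_
      exact LinearMap.congr_fun (e k) x
    simp only [← hg]
    refine existsUnique_hom_CPsi χ hρ hρi h fun x => AdicCompletion.ext fun k => ?_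
    change AdicCompletion.eval I (H.Tens M) k (adicMap I ψ.coact (h x)) =
      AdicCompletion.eval I (H.Tens M) k (adicComparison hI M (H.tensMap h (χ.coact x)))
    rw [← hq, eval_adicComparison, ← tensMap_comp_apply, he, ← (hf k).apply, ← he]
    rfl

end HopfAlgebroid

/-! ### `L_0^Ψ(M)` for comodules whose `L`-completion is the completion -/

namespace HopfAlgebroidData

variable {A Ψ : Type u} [CommRing A] [CommRing Ψ] {H : HopfAlgebroidData A Ψ} {I : Ideal A}
variable {M N : Type u} [AddCommGroup M] [Module A M] [AddCommGroup N] [Module A N]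

theorem L0counit_L0unit (x : M) : L0counit I M (L0unit I M x) = AdicCompletion.of I M x :=
  LinearMap.congr_fun (L0counit_comp_L0unit I) x

/-- The map `Ψ ⊠ L_0 M = L_0(Ψ ⊗ L_0 M) → C^I(Ψ ⊗ M)` that extends
`Ψ ⊗ L_0 M → Ψ ⊗ C^I(M) → C^I(Ψ ⊗ M)`. -/
noncomputable def boxComparison (hI : H.IsInvariant I) (M : Type u) [AddCommGroup M] [Module A M] :
    L0 I (H.Tens (L0 I M)) →ₗ[A] AdicCompletion I (H.Tens M) :=
  L0extend (adicComparison hI M ∘ₗ H.tensMap (L0counit I M))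

theorem boxComparison_L0unit (hI : H.IsInvariant I) (t : H.Tens (L0 I M)) :
    boxComparison hI M (L0unit I _ t) = adicComparison hI M (H.tensMap (L0counit I M) t) :=
  LinearMap.congr_fun (L0extend_comp_L0unit (adicComparison hI M ∘ₗ H.tensMap (L0counit I M))) t

theorem boxComparison_L0map (hI : H.IsInvariant I) (hfg : I.FG) :
    boxComparison hI M ∘ₗ L0map I (H.tensMap (L0unit I M)) = L0counit I (H.Tens M) := by
  apply L0_hom_ext hfg
  refine LinearMap.ext fun t => ?_
  rw [LinearMap.comp_assoc, L0map_comp_L0unit, LinearMap.comp_apply, LinearMap.comp_apply,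
    LinearMap.comp_apply, L0counit_L0unit, boxComparison_L0unit, ← tensMap_comp_apply,
    L0counit_comp_L0unit, adicComparison_tensMap_of]

/-- Modulo `I` every element of `L_0 M` comes from `M`, so `L_0(Ψ ⊗ M) → L_0(Ψ ⊗ L_0 M)` is
surjective. -/
theorem surjective_L0map_tensMap_L0unit (hI : H.IsInvariant I) (hfg : I.FG)
    (hM : Function.Bijective (L0counit I M)) :
    Function.Surjective (L0map I (H.tensMap (L0unit I M))) := by
  have h1 (y : L0 I M) : ∃ m, y - L0unit I M m ∈ (I ^ 1 • ⊤ : Submodule A (L0 I M)) := by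
    obtain ⟨m, hm⟩ := exists_sub_of_mem hfg 1 (L0counit I M y)
    refine ⟨m, ?_⟩
    rw [← L0counit_L0unit, ← map_sub] at hm
    have h := map_mem_smul_top (LinearEquiv.ofBijective _ hM).symm.toLinearMap hm
    have e : (LinearEquiv.ofBijective _ hM).symm.toLinearMap
        (L0counit I M (y - L0unit I M m)) = y - L0unit I M m :=
      (LinearEquiv.ofBijective _ hM).symm_apply_apply _
    rwa [e] at h
  apply surjective_L0map
  intro t
  induction t using H.tens_induction with
  | zero => exact ⟨0, by rw [map_zero, sub_zero]; exact zero_mem _⟩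
  | tmul x y =>
    obtain ⟨m, hm⟩ := h1 y
    refine ⟨H.tmul x m, ?_⟩
    have h := tmul_mem hI 1 x hm
    have e : H.tmul x (y - L0unit I M m) = H.tmul x y - H.tmul x (L0unit I M m) :=
      TensorProduct.tmul_sub _ _ _
    rwa [e, pow_one] at h
  | add s t hs ht =>
    obtain ⟨a, ha⟩ := hs
    obtain ⟨b, hb⟩ := ht
    exact ⟨a + b, by rw [map_add, add_sub_add_comm]; exact add_mem ha hb⟩

theorem injective_boxComparison (hI : H.IsInvariant I) (hfg : I.FG)
    (hM : Function.Bijective (L0counit I M)) (hT : Function.Injective (L0counit I (H.Tens M))) :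
    Function.Injective (boxComparison hI M) := by
  refine Function.Injective.of_comp_right ?_ (surjective_L0map_tensMap_L0unit hI hfg hM)
  rw [← boxComparison_L0map hI hfg] at hT
  exact hT

namespace Coaction

theorem boxComparison_completed (hI : H.IsInvariant I) (hfg : I.FG) (ψ : H.Coaction M)
    (x : L0 I M) :
    boxComparison hI M (ψ.completed I x) = adicMap I ψ.coact (L0counit I M x) := by
  have h1 := LinearMap.congr_fun (boxComparison_L0map (M := M) hI hfg) (L0map I ψ.coact x)
  have h2 := LinearMap.congr_fun (L0counit_natural I ψ.coact) x
  exact h1.trans h2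

/-- A map `f : L_0 X → L_0 M` commutes with the completed coactions if and only if its restriction
to `X` is compatible with the coactions, after composition with `L_0 M → C^I(M)`. -/
theorem isCompletedHom_iff (hI : H.IsInvariant I) (hfg : I.FG) {ψ : H.Coaction M}
    (hβ : Function.Injective (boxComparison hI M)) (χ : H.Coaction N) (f : L0 I N →ₗ[A] L0 I M) :
    χ.IsCompletedHom I ψ f ↔ ∀ x, adicMap I ψ.coact ((L0counit I M ∘ₗ f ∘ₗ L0unit I N) x) =
      adicComparison hI M (H.tensMap (L0counit I M ∘ₗ f ∘ₗ L0unit I N) (χ.coact x)) := by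
  have h1 (x : N) : boxComparison hI M ((ψ.completed I ∘ₗ f) (L0unit I N x)) =
      adicMap I ψ.coact ((L0counit I M ∘ₗ f ∘ₗ L0unit I N) x) :=
    boxComparison_completed hI hfg ψ _
  have h2 (x : N) :
      boxComparison hI M ((L0map I (H.tensMap f) ∘ₗ χ.completed I) (L0unit I N x)) =
        adicComparison hI M (H.tensMap (L0counit I M ∘ₗ f ∘ₗ L0unit I N) (χ.coact x)) := by
    have e : (L0map I (H.tensMap f) ∘ₗ χ.completed I) ∘ₗ L0unit I N =
        L0unit I _ ∘ₗ H.tensMap (f ∘ₗ L0unit I N) ∘ₗ χ.coact := by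
      unfold completed
      rw [← LinearMap.comp_assoc, ← L0map_comp, ← tensMap_comp, ← L0map_comp, L0map_comp_L0unit]
    have e' := LinearMap.congr_fun e x
    rw [LinearMap.comp_apply] at e'
    rw [e', LinearMap.comp_apply, boxComparison_L0unit, LinearMap.comp_apply, ← tensMap_comp_apply]
  constructor
  · intro h x
    rw [← h1, ← h2, h]
  · intro h
    have : boxComparison hI M ∘ₗ (ψ.completed I ∘ₗ f) =
        boxComparison hI M ∘ₗ (L0map I (H.tensMap f) ∘ₗ χ.completed I) :=
      L0_hom_ext hfg (LinearMap.ext fun x => (h1 x).trans ((h x).trans (h2 x).symm))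
    exact LinearMap.ext fun x => hβ (LinearMap.congr_fun this x)

theorem i_epsilon' (hI : H.IsInvariant I) (ψ : H.Coaction M) :
    CPsi.i hI ψ ∘ₗ ψ.epsilon' hI = L0counit I M ∘ₗ LPsi.i I ψ := rfl

theorem p_epsilon' (hI : H.IsInvariant I) (ψ : H.Coaction M) :
    CPsi.p hI ψ ∘ₗ ψ.epsilon' hI = H.tensMap (L0counit I M) ∘ₗ LPsi.p I ψ := rfl

theorem bijective_epsilon' [Module.Flat A (Via H.ηL)] (hI : H.IsInvariant I) (hfg : I.FG)
    (ψ : H.Coaction M) (hM : Function.Bijective (L0counit I M))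
    (hβ : Function.Injective (boxComparison hI M)) : Function.Bijective (ψ.epsilon' hI) := by
  have hT := H.tensMap_injective hM.1
  constructor
  · intro x y h
    exact Subtype.ext (Prod.ext (hM.1 (congrArg (CPsi.i hI ψ) h)) (hT (congrArg (CPsi.p hI ψ) h)))
  · intro z
    obtain ⟨x, hx⟩ := hM.2 (CPsi.i hI ψ z)
    obtain ⟨y, hy⟩ := H.tensMap_surjective hM.2 (CPsi.p hI ψ z)
    refine ⟨⟨(x, y), hβ ?_⟩, Subtype.ext (Prod.ext hx hy)⟩
    change boxComparison hI M (ψ.completed I x) = boxComparison hI M (L0unit I _ y)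
    rw [boxComparison_completed hI hfg, boxComparison_L0unit, hx, hy, CPsi.condition]

end Coaction

end HopfAlgebroidData

namespace HopfAlgebroid

open HopfAlgebroidData Coaction

variable {A Ψ : Type u} [CommRing A] [CommRing Ψ] {H : HopfAlgebroid A Ψ} {I : Ideal A}
variable {M : Type u} [AddCommGroup M] [Module A M]
variable [Module.Flat A (Via H.ηL)] {hI : H.IsInvariant I} {ψ : H.Coaction M}
  {ρL : H.Coaction (ψ.LPsi I)} {ρ : H.Coaction (ψ.CPsi hI)}

theorem tensMap_i_LPsi (hM : Function.Bijective (L0counit I M))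
    (hρi : H.tensMap (CPsi.i hI ψ) ∘ₗ ρ.coact = CPsi.p hI ψ) (hε : IsHom ρL ρ (ψ.epsilon' hI)) :
    H.tensMap (LPsi.i I ψ) ∘ₗ ρL.coact = LPsi.p I ψ := by
  refine LinearMap.ext fun x => H.tensMap_injective hM.1 ?_
  rw [LinearMap.comp_apply, ← tensMap_comp_apply, ← i_epsilon' hI, tensMap_comp_apply, ← hε.apply]
  exact (LinearMap.congr_fun hρi _).trans (LinearMap.congr_fun (p_epsilon' hI ψ) x)

/-- The coreflection `L_0(L_0^Ψ(M)) → L_0 M` extends `i` along the identification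
`L_0 M = C^I(M)`; its universal property is that of the comodule `C^I_Ψ(M)`. -/
theorem isCoreflection_LPsi (hfg : I.FG) (hM : Function.Bijective (L0counit I M))
    (hβ : Function.Injective (boxComparison hI M))
    (hρ : IsHom ρ (H.extended _) (CPsi.p hI ψ))
    (hρi : H.tensMap (CPsi.i hI ψ) ∘ₗ ρ.coact = CPsi.p hI ψ) (hε : IsHom ρL ρ (ψ.epsilon' hI)) :
    ψ.IsCoreflection ρL (LPsi.i I ψ) := by
  let ε := LinearEquiv.ofBijective _ hM
  let e : L0 I (ψ.LPsi I) →ₗ[A] L0 I M :=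
    ε.symm.toLinearMap ∘ₗ L0extend (L0counit I M ∘ₗ LPsi.i I ψ)
  have hεe : L0counit I M ∘ₗ e = L0extend (L0counit I M ∘ₗ LPsi.i I ψ) :=
    LinearMap.ext fun x => ε.apply_symm_apply _
  have hee : L0counit I M ∘ₗ e ∘ₗ L0unit I _ = L0counit I M ∘ₗ LPsi.i I ψ := by
    rw [← LinearMap.comp_assoc, hεe, L0extend_comp_L0unit]
  have he : e ∘ₗ L0unit I _ = LPsi.i I ψ :=
    LinearMap.ext fun x => hM.1 (LinearMap.congr_fun hee x)
  have hbij := bijective_epsilon' hI hfg ψ hM hβ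
  refine ⟨e, (isCompletedHom_iff hI hfg hβ ρL e).2 fun x => ?_, he, fun X _ _ χ f hf => ?_⟩
  · rw [he, ← i_epsilon' hI, tensMap_comp_apply, ← hε.apply, LinearMap.comp_apply, CPsi.condition]
    exact congrArg _ (LinearMap.congr_fun hρi _).symm
  · have hfac (g : X →ₗ[A] ψ.LPsi I) : e ∘ₗ L0map I g = f ↔
        CPsi.i hI ψ ∘ₗ ψ.epsilon' hI ∘ₗ g = L0counit I M ∘ₗ f ∘ₗ L0unit I X := by
      have h1 : (L0counit I M ∘ₗ e ∘ₗ L0map I g) ∘ₗ L0unit I X =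
          CPsi.i hI ψ ∘ₗ ψ.epsilon' hI ∘ₗ g := by
        rw [LinearMap.comp_assoc, LinearMap.comp_assoc, L0map_comp_L0unit,
          ← LinearMap.comp_assoc _ _ e, he]
        rfl
      rw [← h1]
      constructor
      · intro h
        rw [h, LinearMap.comp_assoc]
      · intro h
        have h2 : L0counit I M ∘ₗ e ∘ₗ L0map I g = L0counit I M ∘ₗ f := L0_hom_ext hfg h
        exact LinearMap.ext fun x => hM.1 (LinearMap.congr_fun h2 x)
    obtain ⟨g, ⟨hg1, hg2⟩, hg3⟩ := existsUnique_hom_CPsi χ hρ hρi _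
      ((isCompletedHom_iff hI hfg hβ χ f).1 hf)
    have hg : ψ.epsilon' hI ∘ₗ
        (LinearEquiv.ofBijective _ hbij).symm.toLinearMap ∘ₗ g = g :=
      LinearMap.ext fun x => (LinearEquiv.ofBijective _ hbij).apply_symm_apply _
    refine ⟨(LinearEquiv.ofBijective _ hbij).symm.toLinearMap ∘ₗ g,
      ⟨IsHom.of_comp_injective hbij.1 hε (by rwa [hg]), (hfac _).2 (by rw [hg, hg2])⟩, ?_⟩
    rintro g' ⟨h1, h2⟩
    have h3 := hg3 _ ⟨hε.comp h1, (hfac _).1 h2⟩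
    refine LinearMap.ext fun x => hbij.1 ?_
    exact (LinearMap.congr_fun h3 x).trans (LinearMap.congr_fun hg x).symm

end HopfAlgebroid

theorem mainTheorem10 {A Ψ : Type u} [CommRing A] [IsRegularLocalRing A] [CommRing Ψ]
    (H : HopfAlgebroid A Ψ)
    (hI : H.IsInvariant (IsLocalRing.maximalIdeal A))
    (hΨ : Module.Projective A (Via H.ηL) ∨
      (IsAdicComplete (IsLocalRing.maximalIdeal A) A ∧ Module.Flat A (Via H.ηL) ∧
        Function.Injective (L0unit (IsLocalRing.maximalIdeal A) (Via H.ηL))))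
    (hC : ∀ (N : Type u) [AddCommGroup N] [Module A N] (_ : H.Coaction N),
      Function.Injective (HopfAlgebroidData.adicComparison hI N) ∧
        Function.Injective (HopfAlgebroidData.adicComparison hI (H.Tens N)))
    {M : Type u} [AddCommGroup M] [Module A M] (ψ : H.Coaction M) (hM : ψ.IsFlat) :
    ∃ (ρL : H.Coaction (ψ.LPsi (IsLocalRing.maximalIdeal A)))
      (ρC : H.Coaction (ψ.CPsi hI)),
      (H.tensMap (HopfAlgebroidData.Coaction.LPsi.i _ ψ) ∘ₗ ρL.coact =
          HopfAlgebroidData.Coaction.LPsi.p _ ψ ∧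
        ψ.IsCoreflection ρL (HopfAlgebroidData.Coaction.LPsi.i _ ψ)) ∧
      (H.tensMap (HopfAlgebroidData.Coaction.CPsi.i hI ψ) ∘ₗ ρC.coact =
          HopfAlgebroidData.Coaction.CPsi.p hI ψ ∧
        ψ.IsCompletion hI ρC (fun k =>
          AdicCompletion.eval (IsLocalRing.maximalIdeal A) M k ∘ₗ
            HopfAlgebroidData.Coaction.CPsi.i hI ψ)) ∧
      ρL.IsHom ρC (ψ.epsilon' hI) ∧
      Function.Bijective (ψ.epsilon' hI) := by
  have hfl : Module.Flat A (Via H.ηL) := hΨ.elim (fun h => inferInstance) fun h => h.2.1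
  have hfg : (IsLocalRing.maximalIdeal A).FG := IsNoetherian.noetherian _
  have hTor := hM.injective_idealMul hI
  have hεM : Function.Bijective (L0counit (IsLocalRing.maximalIdeal A) M) :=
    ⟨injective_L0counit fun F _ _ π hπ k => mem_smul_top_ker (hTor k) hπ,
      surjective_L0counit _ M⟩
  have hεT : Function.Injective (L0counit (IsLocalRing.maximalIdeal A) (H.Tens M)) :=
    injective_L0counit fun F _ _ π hπ k =>
      mem_smul_top_ker (HopfAlgebroidData.injective_idealMul_tens hI k (hTor k)) hπ
  have hβ := HopfAlgebroidData.injective_boxComparison hI hfg hεM hεT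
  obtain ⟨ρC, hρ, hρi⟩ := HopfAlgebroid.exists_coaction_CPsi hI ψ (hC M ψ).2
  have hbij := HopfAlgebroidData.Coaction.bijective_epsilon' hI hfg ψ hεM hβ
  obtain ⟨ρL, hε⟩ := HopfAlgebroidData.Coaction.exists_isHom_of_injective ρC hbij.1
    fun x => H.tensMap_surjective hbij.2 _
  exact ⟨ρL, ρC, ⟨HopfAlgebroid.tensMap_i_LPsi hεM hρi hε,
    HopfAlgebroid.isCoreflection_LPsi hfg hεM hβ hρ hρi hε⟩,
    ⟨hρi, HopfAlgebroid.isCompletion_CPsi hρ hρi⟩, hε, hbij⟩
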